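/- **Setting.** Let $\mathcal A$ be a finite nonempty action set, $\mathcal X$ a measurable context space, $\nu$ a probability distribution on $\mathcal X$, and let $r:\mathcal X\times\mathcal A\to[0,1]$ and $\boldsymbol c:\mathcal X\times\mathcal A\to[-1,1]^d$ be measurable expected-reward and expected-cost functions. Let $T$ be the number of rounds and $\boldsymbol B\in[0,1]^d$ the vector of average cost constraints. Inequalities between vectors, and positive parts $(\cdot)_+$ of vectors, are componentwise; $\|\cdot\|$ is the Euclidean norm and $\boldsymbol 1=(1,\dots,1)$. In each round $t=1,\dots,T$ a context $\boldsymbol x_t\sim\nu$ is drawn independently of the past, the learner picks an action $a_t\in\mathcal A$, and then observes a reward $r_t\in[0,1]$ and a cost vector $\boldsymbol c_t\in[-1,1]^d$ whose conditional expectations given the past, $\boldsymbol x_t$ and $a_t$ are $r(\boldsymbol x_t,a_t)$ and $\boldsymbol c(\boldsymbol x_t,a_t)$. **Estimation assumption.** An estimation procedure is given: estimates $\hat r_t:\mathcal X\times\mathcal A\to[0,1]$ and $\hat{\boldsymbol c}_t:\mathcal X\times\mathcal A\to[-1,1]^d$ that are functions of $(\boldsymbol x_s,a_s,r_s,\boldsymbol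 c_s)_{s\le t}$, and error functions $\epsilon_t:\mathcal X\times\mathcal A\times(0,1]\to[0,1]$ that are functions of $(\boldsymbol x_s,a_s)_{s\le t}$, $t=0,1,2,\dots$. It is assumed that, in whatever way contexts and actions are picked (rewards and costs being generated as above), for all $\delta\in(0,1]$, with probability at least $1-\delta$, for all $0\le t\le T$, $\boldsymbol x\in\mathcal X$ and $a\in\mathcal A$, $$|\hat r_t(\boldsymbol x,a)-r(\boldsymbol x,a)|\le\epsilon_t(\boldsymbol x,a,\delta)\quad\text{and}\quad|\hat{\boldsymbol c}_t(\boldsymbol x,a)-\boldsymbol c(\boldsymbol x,a)|\le\epsilon_t(\boldsymbol x,a,\delta)\,\boldsymbol 1 .$$ Let $\beta_{T,\delta}=\sum_{t=1}^T\epsilon_{t-1}(\boldsymbol x_t,a_t,\delta)$. **Strategy.** With $\operatorname{clip}[x]_\ell^u=\min\{\max\{x,\ell\},u\}$ (componentwise for vectors), put $\hat r^{\rm ucb}_{\delta,t}=\operatorname{clip}[\hat r_t+\epsilon_t(\cdot,\cdot,\delta)]_0^1$ and $\hat{\boldsymbol c}^{\rm lcb}_{\delta,t}=\operatorname{clip}[\hat{\boldsymbol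 c}_t-\epsilon_t(\cdot,\cdot,\delta)\boldsymbol 1]_{-1}^1$. The strategy with step size $\gamma>0$, margin $b$ and confidence parameter $\delta$ starts from $\boldsymbol\lambda_0=\boldsymbol 0$ and, in rounds $t=1,\dots,T$, picks an action $a_t$ maximizing over $a\in\mathcal A$ $$\hat r^{\rm ucb}_{\delta,t-1}(\boldsymbol x_t,a)-\bigl\langle\hat{\boldsymbol c}^{\rm lcb}_{\delta,t-1}(\boldsymbol x_t,a)-(\boldsymbol B-b\boldsymbol 1),\boldsymbol\lambda_{t-1}\bigr\rangle$$ and then sets $\boldsymbol\lambda_t=\bigl(\boldsymbol\lambda_{t-1}+\gamma(\hat{\boldsymbol c}^{\rm lcb}_{\delta,t-1}(\boldsymbol x_t,a_t)-(\boldsymbol B-b\boldsymbol 1))\bigr)_+$. **Lemma.** Fix $\delta\in(0,1)$, $\gamma>0$ and $b$ with $0<b<\min_i B_i$. Suppose that the estimation assumption holds and that the problem is feasible for some $\boldsymbol B'<\boldsymbol B-b\boldsymbol 1$ (strictly in every component), i.e. there is a measurable $\boldsymbol\pi=(\pi_a)_{a\in\mathcal A}$ from $\mathcal X$ to the probability distributions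 on $\mathcal A$ with $\mathbb E_{\boldsymbol X\sim\nu}\bigl[\sum_a\boldsymbol c(\boldsymbol X,a)\pi_a(\boldsymbol X)\bigr]\le\boldsymbol B'$. Then the function $$\boldsymbol\lambda\mapsto\mathbb E_{\boldsymbol X\sim\nu}\Bigl[\max_{a\in\mathcal A}\bigl\{r(\boldsymbol X,a)-\langle\boldsymbol c(\boldsymbol X,a)-(\boldsymbol B-b\boldsymbol 1),\boldsymbol\lambda\rangle\bigr\}\Bigr]$$ has a minimizer over $\boldsymbol\lambda\ge\boldsymbol 0$; and for every such minimizer $\boldsymbol\lambda^\star_{\boldsymbol B-b\boldsymbol 1}$, if the strategy is run with confidence parameter $\delta/4$, then with probability at least $1-\delta$, $$\forall\,1\le t\le T,\qquad\Bigl\|\Bigl(\sum_{\tau=1}^t\boldsymbol c_\tau-t(\boldsymbol B-b\boldsymbol 1)\Bigr)_+\Bigr\|\le\frac{1+3\|\boldsymbol\lambda^\star_{\boldsymbol B-b\boldsymbol 1}\|}{\gamma}+20\sqrt d\,\Upsilon_{T,\delta},$$ where $\Upsilon_{T,\delta}=\max\Bigl\{\beta_{T,\delta/4},\ 2\sqrt{dT\ln\frac{T^2}{\delta/4}},\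 \sqrt{2T\ln\frac{2(d+1)T}{\delta/4}}\Bigr\}$. -/

import Mathlib

open MeasureTheory ProbabilityTheory

universe u v w

noncomputable section

namespace CBwK

/-- The unknown part of a contextual bandit problem with knapsacks: a context distribution `ν`
on `X`, an expected-reward function with values in `[0,1]` and an expected-cost function with
values in `[-1,1]^d`. Vectors of `ℝ^d` are functions `Fin d → ℝ`, ordered pointwise. -/
structure Problem (X : Type v) (A : Type w) (d : ℕ) [MeasurableSpace X] where
  ν : Measure X
  isProbabilityMeasure : IsProbabilityMeasure ν
  reward : X → A → ℝ
  cost : X → A → Fin d → ℝ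
  measurable_reward : ∀ a, Measurable fun x => reward x a
  measurable_cost : ∀ a, Measurable fun x => cost x a
  reward_mem : ∀ x a, reward x a ∈ Set.Icc (0 : ℝ) 1
  cost_mem : ∀ x a, cost x a ∈ Set.Icc (-1 : Fin d → ℝ) 1

/-- The Euclidean norm on `ℝ^d`. -/
def euclNorm {d : ℕ} (v : Fin d → ℝ) : ℝ := ‖(WithLp.toLp 2 v : EuclideanSpace ℝ (Fin d))‖

/-- The vector `B - b·1`. -/
def withMargin {d : ℕ} (B : Fin d → ℝ) (b : ℝ) : Fin d → ℝ := fun i => B i - b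

/-- `S` holds with probability at least `p`: it contains an event of probability at least `p`. -/
def HoldsWithProb {Ω : Type u} [MeasurableSpace Ω] (P : Measure Ω) (p : ℝ) (S : Set Ω) : Prop :=
  ∃ E : Set Ω, MeasurableSet E ∧ E ⊆ S ∧ ENNReal.ofReal p ≤ P E

section Policies

variable {X : Type v} {A : Type w} {d : ℕ} [MeasurableSpace X] [Fintype A]

/-- A static policy, i.e. a (measurable) map from contexts to probability vectors on `A`. -/
def IsPolicy (π : X → A → ℝ) : Prop :=
  (∀ a, Measurable fun x => π x a) ∧ (∀ x a, 0 ≤ π x a) ∧ ∀ x, ∑ a, π x a = 1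

/-- Feasibility of the problem for the average cost constraints `B'`. -/
def Feasible (p : Problem X A d) (B' : Fin d → ℝ) : Prop :=
  ∃ π : X → A → ℝ, IsPolicy π ∧ ∀ i, ∫ x, ∑ a, p.cost x a i * π x a ∂p.ν ≤ B' i

/-- The dual objective
`λ ↦ 𝔼_{X ∼ ν} [ max_a { r(X,a) - ⟨c(X,a) - B, λ⟩ } ]` for the cost constraints `B`. -/
def dualObjective [Nonempty A] (p : Problem X A d) (B l : Fin d → ℝ) : ℝ :=
  ∫ x, Finset.univ.sup' Finset.univ_nonempty
    (fun a : A => p.reward x a - (p.cost x a - B) ⬝ᵥ l) ∂p.ν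

/-- `l` is an optimal dual variable `λ⋆_B`: it minimizes the dual objective over `λ ≥ 0`. -/
def IsDualOptimal [Nonempty A] (p : Problem X A d) (B l : Fin d → ℝ) : Prop :=
  0 ≤ l ∧ ∀ μ : Fin d → ℝ, 0 ≤ μ → dualObjective p B l ≤ dualObjective p B μ

end Policies

/-- What is observed in one round: context, action, reward, vector of costs. -/
abbrev Obs (X : Type v) (A : Type w) (d : ℕ) : Type (max v w) := X × A × ℝ × (Fin d → ℝ)

/-- An estimation procedure. At time `t` it maps the observations of rounds `1, …, t` (entry
`s : Fin t` being round `s + 1`) to estimates of the expected rewards and costs, and the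
context–action pairs of rounds `1, …, t` to an error function `ε_t(x, a, δ)`, `δ ∈ (0,1]`. -/
structure EstimationProcedure (X : Type v) (A : Type w) (d : ℕ)
    [MeasurableSpace X] [MeasurableSpace A] where
  rhat : (t : ℕ) → (Fin t → Obs X A d) → X → A → ℝ
  chat : (t : ℕ) → (Fin t → Obs X A d) → X → A → Fin d → ℝ
  err : (t : ℕ) → (Fin t → X × A) → X → A → ℝ → ℝ
  rhat_mem : ∀ t h x a, rhat t h x a ∈ Set.Icc (0 : ℝ) 1
  chat_mem : ∀ t h x a, chat t h x a ∈ Set.Icc (-1 : Fin d → ℝ) 1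
  err_mem : ∀ t h x a, ∀ δ ∈ Set.Ioc (0 : ℝ) 1, err t h x a δ ∈ Set.Icc (0 : ℝ) 1
  measurable_rhat : ∀ t a, Measurable fun q : (Fin t → Obs X A d) × X => rhat t q.1 q.2 a
  measurable_chat : ∀ t a, Measurable fun q : (Fin t → Obs X A d) × X => chat t q.1 q.2 a
  measurable_err : ∀ t a, ∀ δ ∈ Set.Ioc (0 : ℝ) 1,
    Measurable fun q : (Fin t → X × A) × X => err t q.1 q.2 a δ

/-- The random contexts, actions, rewards and costs; rounds are numbered from `1`
(the values at index `0` play no role). -/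
structure Interaction (Ω : Type u) (X : Type v) (A : Type w) (d : ℕ) where
  context : ℕ → Ω → X
  action : ℕ → Ω → A
  reward : ℕ → Ω → ℝ
  cost : ℕ → Ω → Fin d → ℝ

namespace Interaction

variable {Ω : Type u} {X : Type v} {A : Type w} {d : ℕ}

/-- The observations of rounds `1, …, t`. -/
def history (I : Interaction Ω X A d) (t : ℕ) (ω : Ω) : Fin t → Obs X A d :=
  fun s => (I.context (s + 1) ω, I.action (s + 1) ω, I.reward (s + 1) ω, I.cost (s + 1) ω)

/-- The context–action pairs of rounds `1, …, t`. -/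
def pairs (I : Interaction Ω X A d) (t : ℕ) (ω : Ω) : Fin t → X × A :=
  fun s => (I.context (s + 1) ω, I.action (s + 1) ω)

/-- The σ-algebra generated by the observations of rounds `1, …, t`, by the context of round
`t + 1` and by the action of round `t + 1`. -/
@[reducible] def info [MeasurableSpace X] [MeasurableSpace A] (I : Interaction Ω X A d) (t : ℕ) :
    MeasurableSpace Ω :=
  MeasurableSpace.comap (fun ω => (I.history t ω, I.context (t + 1) ω, I.action (t + 1) ω))
    inferInstance

/-- Rewards and costs of rounds `1, …, T` are generated as the problem `p` prescribes: they lie in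
`[0,1]` and `[-1,1]^d`, and given the past, the current context and the current action, their
conditional expectations are `r(x_t, a_t)` and `c(x_t, a_t)`. Nothing is said about how the
contexts and the actions are chosen. -/
structure Follows [MeasurableSpace Ω] [MeasurableSpace X] [MeasurableSpace A]
    (I : Interaction Ω X A d) (p : Problem X A d) (P : Measure Ω) (T : ℕ) : Prop where
  measurable_context : ∀ t < T, Measurable (I.context (t + 1))
  measurable_action : ∀ t < T, Measurable (I.action (t + 1))
  measurable_reward : ∀ t < T, Measurable (I.reward (t + 1))
  measurable_cost : ∀ t < T, Measurable (I.cost (t + 1))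
  reward_mem : ∀ t < T, ∀ ω, I.reward (t + 1) ω ∈ Set.Icc (0 : ℝ) 1
  cost_mem : ∀ t < T, ∀ ω, I.cost (t + 1) ω ∈ Set.Icc (-1 : Fin d → ℝ) 1
  condExp_reward : ∀ t < T, P[I.reward (t + 1) | I.info t] =ᵐ[P]
    fun ω => p.reward (I.context (t + 1) ω) (I.action (t + 1) ω)
  condExp_cost : ∀ t < T, ∀ i, P[fun ω => I.cost (t + 1) ω i | I.info t] =ᵐ[P]
    fun ω => p.cost (I.context (t + 1) ω) (I.action (t + 1) ω) i

/-- In each round `1, …, T` the context is drawn from `ν`, independently of the past. -/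
def ContextsDrawnFrom [MeasurableSpace Ω] [MeasurableSpace X] [MeasurableSpace A]
    (I : Interaction Ω X A d) (ν : Measure X) (P : Measure Ω) (T : ℕ) : Prop :=
  ∀ t < T, P.map (I.context (t + 1)) = ν ∧ IndepFun (I.history t) (I.context (t + 1)) P

end Interaction

namespace EstimationProcedure

variable {Ω : Type u} {X : Type v} {A : Type w} {d : ℕ} [MeasurableSpace X] [MeasurableSpace A]

/-- The sum `β_{T,δ} = ∑_{t=1}^T ε_{t-1}(x_t, a_t, δ)`. -/
def beta (E : EstimationProcedure X A d) (I : Interaction Ω X A d) (T : ℕ) (δ : ℝ) (ω : Ω) : ℝ :=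
  ∑ t ∈ Finset.range T, E.err t (I.pairs t ω) (I.context (t + 1) ω) (I.action (t + 1) ω) δ

/-- The estimation guarantee: however contexts and actions are picked, for every `δ ∈ (0,1]`, with
probability at least `1 - δ` the estimates at all times `0 ≤ t ≤ T` are within the error
functions of the true expected rewards and costs, uniformly over contexts and actions. -/
def IsAccurate (E : EstimationProcedure X A d) (p : Problem X A d) (T : ℕ) : Prop :=
  ∀ (Ω : Type u) [MeasurableSpace Ω] (P : Measure Ω) [IsProbabilityMeasure P]
    (I : Interaction Ω X A d), I.Follows p P T → ∀ δ ∈ Set.Ioc (0 : ℝ) 1,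
      HoldsWithProb P (1 - δ) {ω | ∀ t ≤ T, ∀ (x : X) (a : A),
        |E.rhat t (I.history t ω) x a - p.reward x a| ≤ E.err t (I.pairs t ω) x a δ ∧
        ∀ i, |E.chat t (I.history t ω) x a i - p.cost x a i| ≤ E.err t (I.pairs t ω) x a δ}

/-- Clipped upper confidence bound on the rewards after `t` rounds. -/
def rucb (E : EstimationProcedure X A d) (δ : ℝ) (I : Interaction Ω X A d) (t : ℕ) (ω : Ω)
    (x : X) (a : A) : ℝ :=
  min (max (E.rhat t (I.history t ω) x a + E.err t (I.pairs t ω) x a δ) 0) 1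

/-- Clipped lower confidence bound on the costs after `t` rounds. -/
def clcb (E : EstimationProcedure X A d) (δ : ℝ) (I : Interaction Ω X A d) (t : ℕ) (ω : Ω)
    (x : X) (a : A) : Fin d → ℝ :=
  fun i => min (max (E.chat t (I.history t ω) x a i - E.err t (I.pairs t ω) x a δ) (-1)) 1

/-- The dual variables `λ_0, λ_1, …` of projected gradient descent with step size `γ`. -/
def dualVar (E : EstimationProcedure X A d) (B : Fin d → ℝ) (b γ δ : ℝ)
    (I : Interaction Ω X A d) (ω : Ω) : ℕ → Fin d → ℝ
  | 0 => 0
  | t + 1 => (dualVar E B b γ δ I ω t + γ •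
      (E.clcb δ I t ω (I.context (t + 1) ω) (I.action (t + 1) ω) - withMargin B b))⁺

/-- The quantity maximized over `a` at round `t + 1`. -/
def score (E : EstimationProcedure X A d) (B : Fin d → ℝ) (b γ δ : ℝ)
    (I : Interaction Ω X A d) (t : ℕ) (ω : Ω) (a : A) : ℝ :=
  E.rucb δ I t ω (I.context (t + 1) ω) a -
    (E.clcb δ I t ω (I.context (t + 1) ω) a - withMargin B b) ⬝ᵥ E.dualVar B b γ δ I ω t

/-- The actions of rounds `1, …, T` are picked by the fixed-step-size projected-gradient-descent
strategy run with step size `γ`, margin `b` and confidence level `1 - δ`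
(ties may be broken in any way). -/
def PlayedBy (E : EstimationProcedure X A d) (B : Fin d → ℝ) (b γ δ : ℝ)
    (I : Interaction Ω X A d) (T : ℕ) : Prop :=
  ∀ t < T, ∀ ω a, E.score B b γ δ I t ω a ≤ E.score B b γ δ I t ω (I.action (t + 1) ω)

/-- The deviation term `Υ_{T,δ}`. -/
def upsilon (E : EstimationProcedure X A d) (I : Interaction Ω X A d) (T : ℕ) (δ : ℝ) (ω : Ω) :
    ℝ :=
  max (E.beta I T (δ / 4) ω)
    (max (2 * √(d * T * Real.log ((T : ℝ) ^ 2 / (δ / 4))))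
      √(2 * T * Real.log (2 * ((d : ℝ) + 1) * T / (δ / 4))))

end EstimationProcedure

end CBwK

end

/-!
On the event that the estimates are accurate, the played action maximizes an optimistic version of
the Lagrangian at the dual variable `λ_t`, so the linearized regret of projected gradient descent
against a dual optimum `λ*` is at most the sum of the gaps between the maximal Lagrangians at `λ*`
and at `λ_t`, plus a multiple of `β_T`. By optimality the gaps have non-positive conditional mean,
and their fluctuations form a martingale. Since `D = max_t ‖λ_t - λ*‖` is random,
the fluctuations are truncated at `T` deterministic distances from `λ*`, one of which is within one
gradient step of `D`; the Azuma–Hoeffding inequality at that distance turns the regret bound into a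
quadratic inequality for `D`. Finally the accumulated excess cost is
at most `λ_t / γ` plus the deviations of the estimated and of the observed costs.
-/

namespace CBwK

section HoldsWithProb

variable {Ω ι : Type*} [MeasurableSpace Ω] {P : Measure Ω} {q r : ℝ} {S S' : Set Ω}

theorem HoldsWithProb.mono (h : HoldsWithProb P q S) (hS : S ⊆ S') (hr : r ≤ q) :
    HoldsWithProb P r S' := by
  obtain ⟨F, hF, hFS, hPF⟩ := h
  exact ⟨F, hF, hFS.trans hS, (ENNReal.ofReal_le_ofReal hr).trans hPF⟩

variable [IsProbabilityMeasure P]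

theorem holdsWithProb_iff :
    HoldsWithProb P (1 - q) S ↔ ∃ F, MeasurableSet F ∧ F ⊆ S ∧ P.real Fᶜ ≤ q := by
  refine exists_congr fun F => and_congr_right fun hF => and_congr_right fun _ => ?_
  rw [ENNReal.ofReal_le_iff_le_toReal (measure_ne_top _ _), probReal_compl_eq_one_sub hF,
    Measure.real, sub_le_comm]

theorem holdsWithProb_univ : HoldsWithProb P (1 - 0) Set.univ :=
  holdsWithProb_iff.mpr ⟨_, .univ, subset_rfl, by simp⟩

theorem HoldsWithProb.inter (h : HoldsWithProb P (1 - q) S) (h' : HoldsWithProb P (1 - r) S') :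
    HoldsWithProb P (1 - (q + r)) (S ∩ S') := by
  obtain ⟨F, hF, hFS, hq⟩ := holdsWithProb_iff.mp h
  obtain ⟨F', hF', hFS', hr⟩ := holdsWithProb_iff.mp h'
  refine holdsWithProb_iff.mpr ⟨F ∩ F', hF.inter hF', Set.inter_subset_inter hFS hFS', ?_⟩
  rw [Set.compl_inter]
  exact (measureReal_union_le _ _).trans (add_le_add hq hr)

theorem holdsWithProb_biInter (s : Finset ι) {S : ι → Set Ω}
    (h : ∀ i ∈ s, HoldsWithProb P (1 - r) (S i)) :
    HoldsWithProb P (1 - s.card * r) (⋂ i ∈ s, S i) := by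
  classical
  induction s using Finset.induction_on with
  | empty => simpa using holdsWithProb_univ (P := P)
  | insert i s hi ih =>
    have key := (h i (s.mem_insert_self i)).inter (ih fun j hj => h j (Finset.mem_insert_of_mem hj))
    rw [Finset.set_biInter_insert, Finset.card_insert_of_notMem hi]
    convert key using 2
    push_cast
    ring

end HoldsWithProb

section Azuma

variable {Ω : Type*} {m mΩ : MeasurableSpace Ω} {P : Measure Ω}

theorem exp_mul_le_cosh_add_mul {C x : ℝ} (hx : |x| ≤ C) (s : ℝ) :
    Real.exp (s * x) ≤ Real.cosh (s * C) + x * (Real.sinh (s * C) / C) := by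
  rcases ((abs_nonneg x).trans hx).eq_or_lt with rfl | hC
  · simp [abs_nonpos_iff.mp hx]
  · have ht : |x / C| ≤ 1 := by rwa [abs_div, abs_of_pos hC, div_le_one hC]
    calc Real.exp (s * x) = Real.exp (x / C * (s * C)) := by congr 1; field_simp
      _ ≤ Real.cosh (s * C) + x / C * Real.sinh (s * C) := Real.exp_mul_le_cosh_add_mul_sinh ht _
      _ = _ := by ring

theorem integral_mul_eq_zero_of_condExp_eq_zero [IsFiniteMeasure P] (hm : m ≤ mΩ) {f g : Ω → ℝ}
    (hf : Measurable[m] f) (hfg : Integrable (f * g) P) (hg : Integrable g P)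
    (h0 : P[g | m] =ᵐ[P] 0) : ∫ ω, f ω * g ω ∂P = 0 := by
  rw [← integral_condExp hm, ← integral_zero Ω ℝ (μ := P)]
  refine integral_congr_ae ?_
  filter_upwards [condExp_mul_of_stronglyMeasurable_left hf.stronglyMeasurable hfg hg, h0]
    with ω hω h0ω
  rw [show (fun ω => f ω * g ω) = f * g from rfl, hω, Pi.mul_apply, h0ω, Pi.zero_apply, mul_zero]

theorem hasSubgaussianMGF_add_of_condExp_eq_zero [IsFiniteMeasure P] (hm : m ≤ mΩ)
    {S ξ : Ω → ℝ} {c C : NNReal}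
    (hS : HasSubgaussianMGF S c P) (hSm : Measurable[m] S) (hξ : Measurable ξ)
    (hC : ∀ ω, |ξ ω| ≤ C) (h0 : P[ξ | m] =ᵐ[P] 0) :
    HasSubgaussianMGF (fun ω => S ω + ξ ω) (c + C ^ 2) P := by
  have hexp (s : ℝ) (ω : Ω) : Real.exp (s * (S ω + ξ ω)) ≤
      Real.cosh (s * C) * Real.exp (s * S ω) +
        Real.sinh (s * C) / C * (Real.exp (s * S ω) * ξ ω) := by
    rw [mul_add, Real.exp_add]
    linarith [mul_le_mul_of_nonneg_left (exp_mul_le_cosh_add_mul (hC ω) s)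
      (Real.exp_pos (s * S ω)).le]
  have hmul (s : ℝ) : Integrable (fun ω => Real.exp (s * S ω) * ξ ω) P :=
    (hS.integrable_exp_mul s).mul_bdd (c := C) hξ.aestronglyMeasurable (ae_of_all _ hC)
  have hbound (s : ℝ) := ((hS.integrable_exp_mul s).const_mul (Real.cosh (s * C))).add
    ((hmul s).const_mul (Real.sinh (s * C) / C))
  have hint (s : ℝ) : Integrable (fun ω => Real.exp (s * (S ω + ξ ω))) P :=
    (hbound s).mono' (((hSm.mono hm le_rfl).add hξ).const_mul s).exp.aestronglyMeasurable
      (ae_of_all _ fun ω => by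
        rw [Real.norm_eq_abs, Real.abs_exp]
        exact hexp s ω)
  refine ⟨hint, fun s => ?_⟩
  have horth : ∫ ω, Real.exp (s * S ω) * ξ ω ∂P = 0 :=
    integral_mul_eq_zero_of_condExp_eq_zero hm (hSm.const_mul s).exp (hmul s)
      (.of_bound hξ.aestronglyMeasurable C (ae_of_all _ hC)) h0
  calc mgf (fun ω => S ω + ξ ω) P s
      ≤ ∫ ω, (Real.cosh (s * C) * Real.exp (s * S ω) +
          Real.sinh (s * C) / C * (Real.exp (s * S ω) * ξ ω)) ∂P :=
        integral_mono (hint s) (hbound s) (hexp s)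
    _ = Real.cosh (s * C) * mgf S P s := by
        rw [integral_add ((hS.integrable_exp_mul s).const_mul _) ((hmul s).const_mul _),
          integral_const_mul, integral_const_mul, horth, mul_zero, add_zero, mgf]
    _ ≤ Real.exp ((s * C) ^ 2 / 2) * Real.exp (c * s ^ 2 / 2) :=
        mul_le_mul (Real.cosh_le_exp_half_sq _) (hS.mgf_le s) mgf_nonneg (Real.exp_pos _).le
    _ = Real.exp ((c + C ^ 2 : NNReal) * s ^ 2 / 2) := by
        rw [← Real.exp_add]
        push_cast
        ring_nf

/-- The first `n` terms of the sequence `ξ` are bounded by `C` and centered given the σ-algebras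
`ℱ k`, to which the earlier terms are adapted. The `ℱ k` need not increase: only the partial sum
before time `k` has to be known when `ξ k` is averaged. -/
structure IsBoundedMartingaleDiff (P : Measure Ω) (ℱ : ℕ → MeasurableSpace Ω) (ξ : ℕ → Ω → ℝ)
    (n : ℕ) (C : ℝ) : Prop where
  nonneg : 0 ≤ C
  le : ∀ k < n, ℱ k ≤ mΩ
  measurable_past : ∀ k < n, ∀ j < k, Measurable[ℱ k] (ξ j)
  measurable : ∀ k < n, Measurable (ξ k)
  abs_le : ∀ k < n, ∀ ω, |ξ k ω| ≤ C
  condExp_eq_zero : ∀ k < n, P[ξ k | ℱ k] =ᵐ[P] 0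

namespace IsBoundedMartingaleDiff

variable {ℱ : ℕ → MeasurableSpace Ω} {ξ : ℕ → Ω → ℝ} {n T : ℕ} {C : ℝ}

theorem mono (h : IsBoundedMartingaleDiff P ℱ ξ T C) (hn : n ≤ T) :
    IsBoundedMartingaleDiff P ℱ ξ n C where
  nonneg := h.nonneg
  le k hk := h.le k (hk.trans_le hn)
  measurable_past k hk := h.measurable_past k (hk.trans_le hn)
  measurable k hk := h.measurable k (hk.trans_le hn)
  abs_le k hk := h.abs_le k (hk.trans_le hn)
  condExp_eq_zero k hk := h.condExp_eq_zero k (hk.trans_le hn)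

theorem measurable_sum (h : IsBoundedMartingaleDiff P ℱ ξ n C) :
    Measurable fun ω => ∑ k ∈ Finset.range n, ξ k ω :=
  Finset.measurable_sum _ fun k hk => h.measurable k (Finset.mem_range.mp hk)

variable [IsProbabilityMeasure P]

theorem hasSubgaussianMGF_sum (h : IsBoundedMartingaleDiff P ℱ ξ n C) :
    HasSubgaussianMGF (fun ω => ∑ k ∈ Finset.range n, ξ k ω) (n * C.toNNReal ^ 2) P := by
  induction n with
  | zero => simp
  | succ n ih =>
    have hlast := n.lt_succ_self
    simp only [Finset.sum_range_succ, Nat.cast_succ, add_one_mul]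
    refine hasSubgaussianMGF_add_of_condExp_eq_zero (h.le n hlast) (ih (h.mono n.le_succ))
      (Finset.measurable_sum _ fun k hk => h.measurable_past n hlast k (Finset.mem_range.mp hk))
      (h.measurable n hlast) ?_ (h.condExp_eq_zero n hlast)
    simpa only [Real.coe_toNNReal _ h.nonneg] using h.abs_le n hlast

theorem measureReal_lt_sum_le (h : IsBoundedMartingaleDiff P ℱ ξ n C) (hn : n ≤ T) (L : ℝ) :
    P.real {ω | C * √(2 * T * L) < ∑ k ∈ Finset.range n, ξ k ω} ≤ Real.exp (-L) := by
  have hC := h.nonneg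
  rcases le_or_gt L 0 with hL | hL
  · exact measureReal_le_one.trans (Real.one_le_exp (neg_nonneg.mpr hL))
  rcases (mul_nonneg n.cast_nonneg (sq_nonneg C)).eq_or_lt with hvar | hvar
  · have hsum (ω : Ω) : ∑ k ∈ Finset.range n, ξ k ω ≤ C * √(2 * T * L) :=
      calc ∑ k ∈ Finset.range n, ξ k ω ≤ ∑ _k ∈ Finset.range n, C :=
            Finset.sum_le_sum fun k hk =>
              (_root_.abs_le.mp (h.abs_le k (Finset.mem_range.mp hk) ω)).2
        _ = n * C := by simp
        _ = 0 := by
            rcases mul_eq_zero.mp hvar.symm with hn | hC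
            · rw [hn, zero_mul]
            · rw [pow_eq_zero_iff two_ne_zero |>.mp hC, mul_zero]
        _ ≤ C * √(2 * T * L) := by positivity
    simp only [(hsum _).not_gt, Set.ofPred_false, measureReal_empty, Real.exp_nonneg]
  · calc P.real {ω | C * √(2 * T * L) < ∑ k ∈ Finset.range n, ξ k ω}
        ≤ P.real {ω | C * √(2 * T * L) ≤ ∑ k ∈ Finset.range n, ξ k ω} :=
          measureReal_mono (Set.ofPred_subset_ofPred.mpr fun _ => le_of_lt)
      _ ≤ Real.exp (-(C * √(2 * T * L)) ^ 2 / (2 * (n * C.toNNReal ^ 2 : NNReal))) :=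
          h.hasSubgaussianMGF_sum.measure_ge_le (by positivity)
      _ ≤ Real.exp (-L) := by
          have hnT : (n : ℝ) ≤ T := by exact_mod_cast hn
          refine Real.exp_le_exp.mpr ?_
          rw [mul_pow, Real.sq_sqrt (by positivity)]
          push_cast [Real.coe_toNNReal _ hC]
          rw [div_le_iff₀ (by positivity)]
          nlinarith [mul_le_mul_of_nonneg_right hnT (mul_nonneg (sq_nonneg C) hL.le)]

theorem holdsWithProb_sum_le (h : IsBoundedMartingaleDiff P ℱ ξ T C) (L : ℝ) :
    HoldsWithProb P (1 - T * Real.exp (-L))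
      {ω | ∀ n ≤ T, ∑ k ∈ Finset.range n, ξ k ω ≤ C * √(2 * T * L)} := by
  have hround : ∀ n ∈ Finset.Icc 1 T, HoldsWithProb P (1 - Real.exp (-L))
      {ω | ∑ k ∈ Finset.range n, ξ k ω ≤ C * √(2 * T * L)} := fun n hn => by
    have hnT := (Finset.mem_Icc.mp hn).2
    refine holdsWithProb_iff.mpr
      ⟨_, measurableSet_le (h.mono hnT).measurable_sum measurable_const, subset_rfl, ?_⟩
    simpa only [Set.compl_ofPred, not_le] using (h.mono hnT).measureReal_lt_sum_le hnT L
  have hall := holdsWithProb_biInter _ hround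
  rw [Nat.card_Icc, Nat.add_sub_cancel] at hall
  refine hall.mono (fun ω hω n hn => ?_) le_rfl
  rcases n.eq_zero_or_pos with rfl | hn0
  · rw [Finset.range_zero, Finset.sum_empty]
    exact mul_nonneg h.nonneg (Real.sqrt_nonneg _)
  · exact Set.mem_iInter₂.mp hω n (Finset.mem_Icc.mpr ⟨hn0, hn⟩)

end IsBoundedMartingaleDiff

end Azuma

section FreshSample

variable {Ω β γ : Type*} {m mΩ : MeasurableSpace Ω} [MeasurableSpace β] [MeasurableSpace γ]
  {P : Measure Ω} [IsProbabilityMeasure P] {Y : Ω → β} {x : Ω → γ}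

theorem map_restrict_prodMk_eq_prod_of_indep (hm : m ≤ mΩ) (hY : Measurable[m] Y)
    (hx : Measurable x) (hind : Indep m (MeasurableSpace.comap x inferInstance) P) {s : Set Ω}
    (hs : MeasurableSet[m] s) :
    (P.restrict s).map (fun ω => (Y ω, x ω)) = ((P.restrict s).map Y).prod (P.map x) := by
  have hY' : Measurable Y := hY.mono hm le_rfl
  have := Measure.isProbabilityMeasure_map (μ := P) hx.aemeasurable
  refine (Measure.prod_eq fun u v hu hv => ?_).symm
  rw [Measure.map_apply (hY'.prodMk hx) (hu.prod hv), Measure.map_apply hY' hu,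
    Measure.map_apply hx hv, Measure.restrict_apply' (hm s hs), Measure.restrict_apply' (hm s hs),
    ← (Indep_iff _ _ _).mp hind _ _ ((hY hu).inter hs) ⟨v, hv, rfl⟩, Set.mk_preimage_prod,
    Set.inter_right_comm]

theorem condExp_comp_prodMk_eq_zero_of_indep (hm : m ≤ mΩ) (hY : Measurable[m] Y)
    (hx : Measurable x) (hind : Indep m (MeasurableSpace.comap x inferInstance) P) {f : β × γ → ℝ}
    (hf : Measurable f) (hfi : Integrable (fun ω => f (Y ω, x ω)) P)
    (hf0 : ∀ y, ∫ z, f (y, z) ∂(P.map x) = 0) :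
    P[fun ω => f (Y ω, x ω) | m] =ᵐ[P] 0 := by
  have hYx : Measurable fun ω => (Y ω, x ω) := (hY.mono hm le_rfl).prodMk hx
  refine (ae_eq_condExp_of_forall_setIntegral_eq hm hfi (fun _ _ _ => integrableOn_zero)
    (fun s hs _ => ?_) aestronglyMeasurable_zero).symm
  have hlaw := map_restrict_prodMk_eq_prod_of_indep hm hY hx hind hs
  have hfs : Integrable f (((P.restrict s).map Y).prod (P.map x)) := by
    rw [← hlaw, integrable_map_measure hf.aestronglyMeasurable hYx.aemeasurable]
    exact hfi.integrableOn
  calc ∫ ω in s, (0 : Ω → ℝ) ω ∂P = 0 := by simp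
    _ = ∫ y, ∫ z, f (y, z) ∂(P.map x) ∂((P.restrict s).map Y) := by simp only [hf0, integral_zero]
    _ = ∫ q, f q ∂((P.restrict s).map fun ω => (Y ω, x ω)) := by rw [hlaw, integral_prod f hfs]
    _ = ∫ ω in s, f (Y ω, x ω) ∂P := integral_map hYx.aemeasurable hf.aestronglyMeasurable

end FreshSample

section EuclNorm

variable {d : ℕ}

theorem euclNorm_eq (v : Fin d → ℝ) : euclNorm v = √(∑ i, v i ^ 2) := by
  simp [euclNorm, EuclideanSpace.norm_eq]

theorem euclNorm_sq (v : Fin d → ℝ) : euclNorm v ^ 2 = ∑ i, v i ^ 2 := by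
  rw [euclNorm_eq, Real.sq_sqrt (Finset.sum_nonneg fun i _ => sq_nonneg _)]

theorem euclNorm_nonneg (v : Fin d → ℝ) : 0 ≤ euclNorm v := norm_nonneg _

theorem euclNorm_zero : euclNorm (0 : Fin d → ℝ) = 0 := by
  simp [euclNorm]

theorem euclNorm_add_le (v w : Fin d → ℝ) : euclNorm (v + w) ≤ euclNorm v + euclNorm w :=
  norm_add_le _ _

theorem euclNorm_smul (c : ℝ) (v : Fin d → ℝ) : euclNorm (c • v) = |c| * euclNorm v :=
  norm_smul c (WithLp.toLp 2 v : EuclideanSpace ℝ (Fin d))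

theorem euclNorm_neg (v : Fin d → ℝ) : euclNorm (-v) = euclNorm v :=
  norm_neg (WithLp.toLp 2 v : EuclideanSpace ℝ (Fin d))

theorem euclNorm_sub_comm (v w : Fin d → ℝ) : euclNorm (v - w) = euclNorm (w - v) := by
  rw [← neg_sub, euclNorm_neg]

theorem continuous_euclNorm : Continuous (euclNorm : (Fin d → ℝ) → ℝ) := by
  simp only [funext euclNorm_eq]
  fun_prop

theorem euclNorm_mono_abs {v w : Fin d → ℝ} (h : ∀ i, |v i| ≤ |w i|) :
    euclNorm v ≤ euclNorm w := by
  rw [euclNorm_eq, euclNorm_eq]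
  exact Real.sqrt_le_sqrt (Finset.sum_le_sum fun i _ => sq_le_sq.mpr (h i))

theorem euclNorm_const (c : ℝ) : euclNorm (fun _ : Fin d => c) = √d * |c| := by
  rw [euclNorm_eq]
  simp [Real.sqrt_sq_eq_abs]

theorem euclNorm_posPart_le_of_le {v w : Fin d → ℝ} (hvw : v ≤ w) (hw : 0 ≤ w) :
    euclNorm v⁺ ≤ euclNorm w :=
  euclNorm_mono_abs fun i => by
    rw [Pi.posPart_apply, abs_of_nonneg (posPart_nonneg _), abs_of_nonneg (hw i)]
    exact sup_le (hvw i) (hw i)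

theorem euclNorm_sub_le_two_mul_sqrt {v w : Fin d → ℝ} (hv : v ∈ Set.Icc (-1 : Fin d → ℝ) 1)
    (hw : w ∈ Set.Icc (-1 : Fin d → ℝ) 1) : euclNorm (v - w) ≤ 2 * √d := by
  have hvw (i : Fin d) : |(v - w) i| ≤ |2| := by
    have hvi := abs_le.mpr ⟨hv.1 i, hv.2 i⟩
    have hwi := abs_le.mpr ⟨hw.1 i, hw.2 i⟩
    rw [abs_two, ← one_add_one_eq_two]
    exact (abs_sub _ _).trans (add_le_add hvi hwi)
  rw [mul_comm, ← abs_two, ← euclNorm_const]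
  exact euclNorm_mono_abs hvw

theorem abs_dotProduct_le (v w : Fin d → ℝ) : |v ⬝ᵥ w| ≤ euclNorm v * euclNorm w := by
  rw [← Real.sqrt_sq_eq_abs, euclNorm_eq, euclNorm_eq, ← Real.sqrt_mul
    (Finset.sum_nonneg fun i _ => sq_nonneg _)]
  exact Real.sqrt_le_sqrt (Finset.sum_mul_sq_le_sq_mul_sq _ _ _)

theorem sum_le_sqrt_mul_euclNorm (v : Fin d → ℝ) : ∑ i, v i ≤ √d * euclNorm v := by
  have h := (le_abs_self _).trans (abs_dotProduct_le (fun _ : Fin d => (1 : ℝ)) v)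
  rw [euclNorm_const] at h
  simpa [dotProduct] using h

theorem euclNorm_posPart_sub_le {l : Fin d → ℝ} (hl : 0 ≤ l) (v : Fin d → ℝ) :
    euclNorm (v⁺ - l) ≤ euclNorm (v - l) :=
  euclNorm_mono_abs fun i => by
    have hli : l i ⊔ 0 = l i := sup_of_le_left (hl i)
    rw [Pi.sub_apply, Pi.sub_apply, Pi.posPart_apply, posPart_def]
    simpa only [hli] using abs_max_sub_max_le_abs (v i) (l i) 0

theorem euclNorm_posPart_add_smul_sub_sq_le {l : Fin d → ℝ} (hl : 0 ≤ l) (m g : Fin d → ℝ)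
    (γ : ℝ) :
    euclNorm ((m + γ • g)⁺ - l) ^ 2 ≤
      euclNorm (m - l) ^ 2 + 2 * γ * (g ⬝ᵥ (m - l)) + γ ^ 2 * euclNorm g ^ 2 := by
  refine (pow_le_pow_left₀ (euclNorm_nonneg _) (euclNorm_posPart_sub_le hl _) 2).trans_eq ?_
  simp only [euclNorm_sq, dotProduct, Finset.mul_sum, ← Finset.sum_add_distrib, Pi.sub_apply,
    Pi.add_apply, Pi.smul_apply, smul_eq_mul]
  exact Finset.sum_congr rfl fun i _ => by ring

end EuclNorm

section Dual

variable {X A : Type*} {d : ℕ} [MeasurableSpace X] [Fintype A] [Nonempty A] {p : Problem X A d}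
  {B B' l m : Fin d → ℝ} {D : ℝ} {x : X}

/-- The integrand `max_a { r(x,a) - ⟨c(x,a) - B, l⟩ }` of the dual objective. -/
noncomputable def lagrangianMax (p : Problem X A d) (B l : Fin d → ℝ) (x : X) : ℝ :=
  Finset.univ.sup' Finset.univ_nonempty (fun a : A => p.reward x a - (p.cost x a - B) ⬝ᵥ l)

theorem le_lagrangianMax (p : Problem X A d) (B l : Fin d → ℝ) (x : X) (a : A) :
    p.reward x a - (p.cost x a - B) ⬝ᵥ l ≤ lagrangianMax p B l x :=
  Finset.le_sup' (fun a : A => p.reward x a - (p.cost x a - B) ⬝ᵥ l) (Finset.mem_univ a)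

theorem lagrangianMax_le {z : ℝ} (h : ∀ a, p.reward x a - (p.cost x a - B) ⬝ᵥ l ≤ z) :
    lagrangianMax p B l x ≤ z :=
  Finset.sup'_le _ _ fun a _ => h a

theorem dualObjective_eq_integral (p : Problem X A d) (B l : Fin d → ℝ) :
    dualObjective p B l = ∫ x, lagrangianMax p B l x ∂p.ν := rfl

theorem lagrangianMax_zero_mem (p : Problem X A d) (B : Fin d → ℝ) (x : X) :
    lagrangianMax p B 0 x ∈ Set.Icc (0 : ℝ) 1 := by
  refine ⟨?_, lagrangianMax_le fun a => by simpa using (p.reward_mem x a).2⟩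
  obtain ⟨a⟩ := ‹Nonempty A›
  exact (p.reward_mem x a).1.trans (by simpa using le_lagrangianMax p B 0 x a)

theorem lagrangianMax_sub_le (hB : B ∈ Set.Icc (-1 : Fin d → ℝ) 1) (l m : Fin d → ℝ) (x : X) :
    lagrangianMax p B l x - lagrangianMax p B m x ≤ 2 * √d * euclNorm (l - m) := by
  rw [sub_le_iff_le_add]
  refine lagrangianMax_le fun a => ?_
  have hcost : (p.cost x a - B) ⬝ᵥ (m - l) ≤ 2 * √d * euclNorm (m - l) :=
    ((le_abs_self _).trans (abs_dotProduct_le _ _)).trans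
      (mul_le_mul_of_nonneg_right (euclNorm_sub_le_two_mul_sqrt (p.cost_mem x a) hB)
        (euclNorm_nonneg _))
  rw [dotProduct_sub, euclNorm_sub_comm] at hcost
  linarith [le_lagrangianMax p B m x a]

theorem abs_lagrangianMax_sub_le (hB : B ∈ Set.Icc (-1 : Fin d → ℝ) 1) (l m : Fin d → ℝ)
    (x : X) : |lagrangianMax p B l x - lagrangianMax p B m x| ≤ 2 * √d * euclNorm (l - m) := by
  refine abs_sub_le_iff.mpr ⟨lagrangianMax_sub_le hB l m x, ?_⟩
  rw [euclNorm_sub_comm]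
  exact lagrangianMax_sub_le hB m l x

theorem measurable_uncurry_lagrangianMax (p : Problem X A d) (B : Fin d → ℝ) :
    Measurable fun q : (Fin d → ℝ) × X => lagrangianMax p B q.1 q.2 := by
  have hsup : (fun q : (Fin d → ℝ) × X => lagrangianMax p B q.1 q.2) =
      Finset.univ.sup' Finset.univ_nonempty (fun (a : A) (q : (Fin d → ℝ) × X) =>
        p.reward q.2 a - (p.cost q.2 a - B) ⬝ᵥ q.1) := by
    ext q
    rw [Finset.sup'_apply, lagrangianMax]
  rw [hsup]
  refine Finset.measurable_sup' _ fun a _ => ((p.measurable_reward a).comp measurable_snd).sub ?_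
  have hcost (i : Fin d) : Measurable fun q : (Fin d → ℝ) × X => p.cost q.2 a i :=
    (measurable_pi_iff.mp (p.measurable_cost a) i).comp measurable_snd
  exact Finset.measurable_sum _ fun i _ =>
    ((hcost i).sub_const (B i)).mul ((measurable_pi_apply i).comp measurable_fst)

theorem measurable_lagrangianMax (p : Problem X A d) (B l : Fin d → ℝ) :
    Measurable (lagrangianMax p B l) :=
  (measurable_uncurry_lagrangianMax p B).comp measurable_prodMk_left

theorem integrable_lagrangianMax (hB : B ∈ Set.Icc (-1 : Fin d → ℝ) 1) (l : Fin d → ℝ) :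
    Integrable (lagrangianMax p B l) p.ν := by
  have := p.isProbabilityMeasure
  refine .of_bound (measurable_lagrangianMax p B l).aestronglyMeasurable
    (1 + 2 * √d * euclNorm l) (ae_of_all _ fun x => ?_)
  have hsub := abs_lagrangianMax_sub_le (p := p) hB l 0 x
  obtain ⟨hnonneg, hle_one⟩ := lagrangianMax_zero_mem p B x
  rw [sub_zero, abs_le] at hsub
  rw [Real.norm_eq_abs, abs_le]
  constructor <;> linarith [hsub.1, hsub.2]

theorem abs_dualObjective_sub_le (hB : B ∈ Set.Icc (-1 : Fin d → ℝ) 1) (l m : Fin d → ℝ) :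
    |dualObjective p B l - dualObjective p B m| ≤ 2 * √d * euclNorm (l - m) := by
  have := p.isProbabilityMeasure
  rw [dualObjective_eq_integral, dualObjective_eq_integral,
    ← integral_sub (integrable_lagrangianMax hB l) (integrable_lagrangianMax hB m)]
  simpa using norm_integral_le_of_norm_le_const (μ := p.ν)
    (f := fun x => lagrangianMax p B l x - lagrangianMax p B m x)
    (ae_of_all _ fun x => abs_lagrangianMax_sub_le hB l m x)

theorem continuous_dualObjective (hB : B ∈ Set.Icc (-1 : Fin d → ℝ) 1) :
    Continuous (dualObjective p B) := by
  refine continuous_iff_continuousAt.mpr fun m => tendsto_iff_dist_tendsto_zero.mpr ?_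
  refine squeeze_zero (fun _ => dist_nonneg) (fun l => abs_dualObjective_sub_le hB l m) ?_
  have hcont : Continuous fun l : Fin d → ℝ => 2 * √(d : ℝ) * euclNorm (l - m) :=
    continuous_const.mul (continuous_euclNorm.comp (continuous_id.sub continuous_const))
  simpa [euclNorm_zero] using hcont.tendsto m

theorem dualObjective_zero_le_one (hB : B ∈ Set.Icc (-1 : Fin d → ℝ) 1) :
    dualObjective p B 0 ≤ 1 := by
  have := p.isProbabilityMeasure
  simpa [dualObjective_eq_integral] using
    integral_mono (integrable_lagrangianMax (p := p) hB 0) (integrable_const (1 : ℝ))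
      fun x => (lagrangianMax_zero_mem p B x).2

theorem dotProduct_sub_sum_le_lagrangianMax {w : A → ℝ} (hw0 : ∀ a, 0 ≤ w a)
    (hw1 : ∑ a, w a = 1) (l : Fin d → ℝ) (x : X) :
    (B - ∑ a, w a • p.cost x a) ⬝ᵥ l ≤ lagrangianMax p B l x := by
  have hmean : B - ∑ a, w a • p.cost x a = ∑ a, w a • (B - p.cost x a) := by
    simp only [smul_sub, Finset.sum_sub_distrib, ← Finset.sum_smul, hw1, one_smul]
  calc (B - ∑ a, w a • p.cost x a) ⬝ᵥ l = ∑ a, w a * ((B - p.cost x a) ⬝ᵥ l) := by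
        simp only [hmean, sum_dotProduct, smul_dotProduct, smul_eq_mul]
    _ ≤ ∑ a, w a * lagrangianMax p B l x := by
        refine Finset.sum_le_sum fun a _ => mul_le_mul_of_nonneg_left ?_ (hw0 a)
        rw [← neg_sub, neg_dotProduct]
        linarith [le_lagrangianMax p B l x a, (p.reward_mem x a).1]
    _ = lagrangianMax p B l x := by rw [← Finset.sum_mul, hw1, one_mul]

theorem Feasible.dotProduct_sub_le_dualObjective (h : Feasible p B')
    (hB : B ∈ Set.Icc (-1 : Fin d → ℝ) 1) (hl : 0 ≤ l) :
    (B - B') ⬝ᵥ l ≤ dualObjective p B l := by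
  have := p.isProbabilityMeasure
  obtain ⟨π, ⟨hπm, hπ0, hπ1⟩, hπB⟩ := h
  set c : X → Fin d → ℝ := fun x => ∑ a, π x a • p.cost x a with hc
  have hc_apply (x : X) (i : Fin d) : c x i = ∑ a, p.cost x a i * π x a := by
    simp [hc, mul_comm]
  have hc_mem (x : X) : c x ∈ Set.Icc (-1 : Fin d → ℝ) 1 :=
    (convex_Icc _ _).sum_mem (fun a _ => hπ0 x a) (hπ1 x) fun a _ => p.cost_mem x a
  have hc_int (i : Fin d) : Integrable (fun x => c x i) p.ν := by
    refine .of_bound (Measurable.aestronglyMeasurable ?_) 1 (ae_of_all _ fun x =>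
      abs_le.mpr ⟨(hc_mem x).1 i, (hc_mem x).2 i⟩)
    simp only [hc_apply]
    exact Finset.measurable_sum _ fun a _ =>
      (measurable_pi_iff.mp (p.measurable_cost a) i).mul (hπm a)
  have hdot_int (i : Fin d) : Integrable (fun x => (B i - c x i) * l i) p.ν :=
    ((integrable_const _).sub (hc_int i)).mul_const _
  calc (B - B') ⬝ᵥ l ≤ ∑ i, ∫ x, (B i - c x i) * l i ∂p.ν := by
        refine Finset.sum_le_sum fun i _ => ?_
        rw [integral_mul_const, integral_sub (integrable_const _) (hc_int i), integral_const,
          probReal_univ, one_smul]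
        simp only [hc_apply]
        exact mul_le_mul_of_nonneg_right (sub_le_sub_left (hπB i) _) (hl i)
    _ = ∫ x, (B - c x) ⬝ᵥ l ∂p.ν := (integral_finsetSum _ fun i _ => hdot_int i).symm
    _ ≤ dualObjective p B l :=
        integral_mono (integrable_finsetSum _ fun i _ => hdot_int i)
          (integrable_lagrangianMax hB l)
          fun x => dotProduct_sub_sum_le_lagrangianMax (hπ0 x) (hπ1 x) l x

theorem Feasible.exists_isDualOptimal (h : Feasible p B') (hB : B ∈ Set.Icc (-1 : Fin d → ℝ) 1)
    (hB' : ∀ i, B' i < B i) : ∃ l, IsDualOptimal p B l := by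
  have hgap (i : Fin d) : 0 < (B - B') i := sub_pos.mpr (hB' i)
  have hcompact : IsCompact (Set.Icc (0 : Fin d → ℝ) (B - B')⁻¹) := isCompact_Icc
  have hzero : (0 : Fin d → ℝ) ∈ Set.Icc 0 (B - B')⁻¹ :=
    ⟨le_rfl, fun i => (inv_pos.mpr (hgap i)).le⟩
  obtain ⟨l, hl, hmin⟩ :=
    hcompact.exists_isMinOn ⟨0, hzero⟩ (continuous_dualObjective (p := p) hB).continuousOn
  refine ⟨l, hl.1, fun m hm => ?_⟩
  by_cases hmR : m ≤ (B - B')⁻¹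
  · exact hmin ⟨hm, hmR⟩
  obtain ⟨i, hi⟩ : ∃ i, ((B - B') i)⁻¹ < m i := by
    simpa [Pi.le_def] using hmR
  calc dualObjective p B l ≤ dualObjective p B 0 := hmin hzero
    _ ≤ 1 := dualObjective_zero_le_one hB
    _ ≤ (B - B') i * m i := ((inv_lt_iff_one_lt_mul₀' (hgap i)).mp hi).le
    _ ≤ (B - B') ⬝ᵥ m :=
        Finset.single_le_sum (f := fun j => (B - B') j * m j)
          (fun j _ => mul_nonneg (hgap j).le (hm j)) (Finset.mem_univ i)
    _ ≤ dualObjective p B m := h.dotProduct_sub_le_dualObjective hB hm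

/-- The fluctuation at the context `x` of `lagrangianMax p B l - lagrangianMax p B m` around its
mean `dualObjective p B l - dualObjective p B m`. -/
noncomputable def dualGap (p : Problem X A d) (B l m : Fin d → ℝ) (x : X) : ℝ :=
  lagrangianMax p B l x - lagrangianMax p B m x - (dualObjective p B l - dualObjective p B m)

theorem measurable_uncurry_dualGap (hB : B ∈ Set.Icc (-1 : Fin d → ℝ) 1) (l : Fin d → ℝ) :
    Measurable fun q : (Fin d → ℝ) × X => dualGap p B l q.1 q.2 :=
  (((measurable_lagrangianMax p B l).comp measurable_snd).sub
    (measurable_uncurry_lagrangianMax p B)).sub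
      (((continuous_dualObjective hB).measurable.comp measurable_fst).const_sub _)

theorem abs_dualGap_le (hB : B ∈ Set.Icc (-1 : Fin d → ℝ) 1) (l m : Fin d → ℝ) (x : X) :
    |dualGap p B l m x| ≤ 4 * √d * euclNorm (m - l) := by
  refine (abs_sub _ _).trans ?_
  rw [euclNorm_sub_comm]
  linarith [abs_lagrangianMax_sub_le (p := p) hB l m x, abs_dualObjective_sub_le (p := p) hB l m]

theorem integral_dualGap (hB : B ∈ Set.Icc (-1 : Fin d → ℝ) 1) (l m : Fin d → ℝ) :
    ∫ x, dualGap p B l m x ∂p.ν = 0 := by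
  have := p.isProbabilityMeasure
  have hl := integrable_lagrangianMax (p := p) hB l
  have hm := integrable_lagrangianMax (p := p) hB m
  have hlm : Integrable (fun x => lagrangianMax p B l x - lagrangianMax p B m x) p.ν := hl.sub hm
  simp only [dualGap]
  rw [integral_sub hlm (integrable_const _), integral_sub hl hm, integral_const,
    probReal_univ, one_smul, dualObjective_eq_integral, dualObjective_eq_integral, sub_self]

open Classical in
/-- The dual gap, set to zero where `m` is at distance more than `D` from `l`. The truncation makes
it bounded, so that its sum along the unbounded dual variables obeys a concentration bound. -/
noncomputable def truncGap (p : Problem X A d) (B l : Fin d → ℝ) (D : ℝ) (m : Fin d → ℝ) (x : X) :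
    ℝ :=
  if euclNorm (m - l) ≤ D then dualGap p B l m x else 0

theorem truncGap_of_le (h : euclNorm (m - l) ≤ D) : truncGap p B l D m x = dualGap p B l m x :=
  if_pos h

theorem measurable_uncurry_truncGap (hB : B ∈ Set.Icc (-1 : Fin d → ℝ) 1) (l : Fin d → ℝ)
    (D : ℝ) : Measurable fun q : (Fin d → ℝ) × X => truncGap p B l D q.1 q.2 :=
  .ite (measurableSet_le (continuous_euclNorm.measurable.comp (measurable_fst.sub_const l))
    measurable_const) (measurable_uncurry_dualGap hB l) measurable_const

theorem abs_truncGap_le (hB : B ∈ Set.Icc (-1 : Fin d → ℝ) 1) (hD : 0 ≤ D) (l m : Fin d → ℝ)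
    (x : X) : |truncGap p B l D m x| ≤ 4 * √d * D := by
  rw [truncGap]
  split_ifs with h
  · exact (abs_dualGap_le hB l m x).trans (by gcongr)
  · rw [abs_zero]
    positivity

theorem integral_truncGap (hB : B ∈ Set.Icc (-1 : Fin d → ℝ) 1) (l : Fin d → ℝ) (D : ℝ)
    (m : Fin d → ℝ) : ∫ x, truncGap p B l D m x ∂p.ν = 0 := by
  by_cases h : euclNorm (m - l) ≤ D
  · simp only [truncGap_of_le h, integral_dualGap hB l m]
  · simp only [truncGap, if_neg h, integral_zero]

end Dual

section Measurability

variable {Ω X A : Type*} {d t T : ℕ} {m : MeasurableSpace Ω} [MeasurableSpace X]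
  [MeasurableSpace A] {p : Problem X A d} {I : Interaction Ω X A d} {E : EstimationProcedure X A d}
  {B : Fin d → ℝ} {b γ δ : ℝ}

namespace Interaction

theorem measurable_obs_of_measurable_history (h : Measurable (I.history t)) {s : ℕ} (hs : s < t) :
    Measurable fun ω => (I.context (s + 1) ω, I.action (s + 1) ω, I.reward (s + 1) ω,
      I.cost (s + 1) ω) :=
  measurable_pi_iff.mp h ⟨s, hs⟩

theorem measurable_history_of_le (h : Measurable (I.history t)) {s : ℕ} (hs : s ≤ t) :
    Measurable (I.history s) :=
  measurable_pi_iff.mpr fun j => measurable_obs_of_measurable_history h (j.2.trans_le hs)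

theorem measurable_pairs_of_measurable_history (h : Measurable (I.history t)) :
    Measurable (I.pairs t) :=
  measurable_pi_iff.mpr fun j =>
    have hobs := measurable_obs_of_measurable_history h j.2
    hobs.fst.prodMk hobs.snd.fst

theorem Follows.measurable_history {P : Measure Ω} (hI : I.Follows p P T) (ht : t ≤ T) :
    Measurable (I.history t) :=
  measurable_pi_iff.mpr fun j =>
    have hj : (j : ℕ) < T := j.2.trans_le ht
    (hI.measurable_context j hj).prodMk ((hI.measurable_action j hj).prodMk
      ((hI.measurable_reward j hj).prodMk (hI.measurable_cost j hj)))

theorem Follows.info_le {P : Measure Ω} (hI : I.Follows p P T) (ht : t < T) : I.info t ≤ m :=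
  ((hI.measurable_history ht.le).prodMk
    ((hI.measurable_context t ht).prodMk (hI.measurable_action t ht))).comap_le

theorem measurable_info_round (I : Interaction Ω X A d) (t : ℕ) :
    Measurable[I.info t] fun ω => (I.history t ω, I.context (t + 1) ω, I.action (t + 1) ω) :=
  comap_measurable _

end Interaction

variable [Countable A] [MeasurableSingletonClass A] {x : Ω → X} {a : Ω → A}

theorem Problem.measurable_cost_comp (p : Problem X A d) (hx : Measurable x) (ha : Measurable a)
    (i : Fin d) : Measurable fun ω => p.cost (x ω) (a ω) i := by
  have hcost : Measurable fun q : X × A => p.cost q.1 q.2 i :=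
    measurable_from_prod_countable_left fun a => measurable_pi_iff.mp (p.measurable_cost a) i
  exact hcost.comp (hx.prodMk ha)

namespace EstimationProcedure

theorem measurable_clcb (hδ : δ ∈ Set.Ioc (0 : ℝ) 1) (h : Measurable (I.history t))
    (hx : Measurable x) (ha : Measurable a) :
    Measurable fun ω => E.clcb δ I t ω (x ω) (a ω) := by
  have hchat : Measurable fun q : ((Fin t → Obs X A d) × X) × A => E.chat t q.1.1 q.1.2 q.2 :=
    measurable_from_prod_countable_left fun a => E.measurable_chat t a
  have herr : Measurable fun q : ((Fin t → X × A) × X) × A => E.err t q.1.1 q.1.2 q.2 δ :=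
    measurable_from_prod_countable_left fun a => E.measurable_err t a δ hδ
  have hchat_comp := measurable_pi_iff.mp (hchat.comp ((h.prodMk hx).prodMk ha))
  have herr_comp := herr.comp
    (((Interaction.measurable_pairs_of_measurable_history h).prodMk hx).prodMk ha)
  exact measurable_pi_iff.mpr fun i =>
    (((hchat_comp i).sub herr_comp).max measurable_const).min measurable_const

theorem measurable_dualVar (hδ : δ ∈ Set.Ioc (0 : ℝ) 1) (h : Measurable (I.history t)) :
    Measurable fun ω => E.dualVar B b γ δ I ω t := by
  induction t with
  | zero => exact measurable_const
  | succ t ih =>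
    have hpast := Interaction.measurable_history_of_le h t.le_succ
    have hobs := Interaction.measurable_obs_of_measurable_history h t.lt_succ_self
    have hcost : Measurable fun ω =>
        E.clcb δ I t ω (I.context (t + 1) ω) (I.action (t + 1) ω) :=
      measurable_clcb hδ hpast hobs.fst hobs.snd.fst
    have hstep := (ih hpast).add ((hcost.sub_const (withMargin B b)).const_smul γ)
    exact measurable_pi_iff.mpr fun i => (measurable_pi_iff.mp hstep i).sup_const 0

end EstimationProcedure

end Measurability

section Deviations

variable {Ω X A : Type*} {d T : ℕ} {m mΩ : MeasurableSpace Ω} [MeasurableSpace X]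
  [MeasurableSpace A] [MeasurableSingletonClass A]
  {P : Measure Ω} [IsProbabilityMeasure P] {p : Problem X A d} {I : Interaction Ω X A d}

/-- The excess of the cost of type `i` in round `t + 1` over its conditional expectation. -/
noncomputable def costNoise (p : Problem X A d) (I : Interaction Ω X A d) (i : Fin d) (t : ℕ)
    (ω : Ω) : ℝ :=
  I.cost (t + 1) ω i - p.cost (I.context (t + 1) ω) (I.action (t + 1) ω) i

theorem measurable_costNoise_of_measurable_history [Countable A] {s t : ℕ}
    (h : Measurable[m] (I.history t)) (hs : s < t) (i : Fin d) :
    Measurable[m] (costNoise p I i s) :=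
  have hobs := Interaction.measurable_obs_of_measurable_history h hs
  (measurable_pi_iff.mp hobs.snd.snd.snd i).sub
    (p.measurable_cost_comp hobs.fst hobs.snd.fst i)

theorem condExp_costNoise [Countable A] (hI : I.Follows p P T) {t : ℕ} (ht : t < T) (i : Fin d) :
    P[costNoise p I i t | I.info t] =ᵐ[P] 0 := by
  have hround := I.measurable_info_round t
  have hmean_info : Measurable[I.info t]
      fun ω => p.cost (I.context (t + 1) ω) (I.action (t + 1) ω) i :=
    p.measurable_cost_comp hround.snd.fst hround.snd.snd i
  have hmean : Integrable (fun ω => p.cost (I.context (t + 1) ω) (I.action (t + 1) ω) i) P :=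
    .of_bound (hmean_info.mono (hI.info_le ht) le_rfl).aestronglyMeasurable 1 (ae_of_all _ fun ω =>
      abs_le.mpr ⟨(p.cost_mem _ _).1 i, (p.cost_mem _ _).2 i⟩)
  have hcost : Integrable (fun ω => I.cost (t + 1) ω i) P :=
    .of_bound (measurable_pi_iff.mp (hI.measurable_cost t ht) i).aestronglyMeasurable 1
      (ae_of_all _ fun ω => abs_le.mpr ⟨(hI.cost_mem t ht ω).1 i, (hI.cost_mem t ht ω).2 i⟩)
  filter_upwards [condExp_sub hcost hmean (I.info t), hI.condExp_cost t ht i] with ω hsub hcond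
  rw [condExp_of_stronglyMeasurable (hI.info_le ht) hmean_info.stronglyMeasurable hmean,
    Pi.sub_apply, hcond, sub_self] at hsub
  exact hsub

theorem isBoundedMartingaleDiff_costNoise [Countable A] (hI : I.Follows p P T) (i : Fin d) :
    IsBoundedMartingaleDiff P I.info (costNoise p I i) T 2 where
  nonneg := zero_le_two
  le k hk := hI.info_le hk
  measurable_past k _ j hj :=
    measurable_costNoise_of_measurable_history (I.measurable_info_round k).fst hj i
  measurable k hk := measurable_costNoise_of_measurable_history (hI.measurable_history le_rfl) hk i
  abs_le k hk ω := by
    have hcost := abs_le.mpr ⟨(hI.cost_mem k hk ω).1 i, (hI.cost_mem k hk ω).2 i⟩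
    have hmean := abs_le.mpr ⟨(p.cost_mem (I.context (k + 1) ω) (I.action (k + 1) ω)).1 i,
      (p.cost_mem (I.context (k + 1) ω) (I.action (k + 1) ω)).2 i⟩
    rw [← one_add_one_eq_two]
    exact (abs_sub _ _).trans (add_le_add hcost hmean)
  condExp_eq_zero k hk := condExp_costNoise hI hk i

variable [Fintype A] [Nonempty A] {E : EstimationProcedure X A d} {B B' l : Fin d → ℝ}
  {b γ δ D : ℝ}

theorem measurable_truncGap_dualVar (hB' : B' ∈ Set.Icc (-1 : Fin d → ℝ) 1)
    (hδ : δ ∈ Set.Ioc (0 : ℝ) 1) {s t : ℕ} (h : Measurable[m] (I.history t)) (hs : s < t) :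
    Measurable[m] fun ω =>
      truncGap p B' l D (E.dualVar B b γ δ I ω s) (I.context (s + 1) ω) := by
  have hdual : Measurable[m] fun ω => E.dualVar B b γ δ I ω s :=
    E.measurable_dualVar hδ (Interaction.measurable_history_of_le h hs.le)
  have hctx : Measurable[m] fun ω => I.context (s + 1) ω :=
    (Interaction.measurable_obs_of_measurable_history h hs).fst
  have hgap := (measurable_uncurry_truncGap (p := p) hB' l D).comp (hdual.prodMk hctx)
  exact hgap

theorem isBoundedMartingaleDiff_truncGap (hB' : B' ∈ Set.Icc (-1 : Fin d → ℝ) 1)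
    (hδ : δ ∈ Set.Ioc (0 : ℝ) 1) (hI : I.Follows p P T) (hctx : I.ContextsDrawnFrom p.ν P T)
    (hD : 0 ≤ D) :
    IsBoundedMartingaleDiff P (fun k => MeasurableSpace.comap (I.history k) inferInstance)
      (fun k ω => truncGap p B' l D (E.dualVar B b γ δ I ω k) (I.context (k + 1) ω)) T
      (4 * √d * D) where
  nonneg := by positivity
  le k hk := (hI.measurable_history hk.le).comap_le
  measurable_past k _ j hj := measurable_truncGap_dualVar hB' hδ (comap_measurable _) hj
  measurable k hk := measurable_truncGap_dualVar hB' hδ (hI.measurable_history le_rfl) hk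
  abs_le k _ ω := abs_truncGap_le hB' hD l _ _
  condExp_eq_zero k hk := by
    have hmeas : Measurable fun ω =>
        truncGap p B' l D (E.dualVar B b γ δ I ω k) (I.context (k + 1) ω) :=
      measurable_truncGap_dualVar hB' hδ (hI.measurable_history le_rfl) hk
    refine condExp_comp_prodMk_eq_zero_of_indep (hI.measurable_history hk.le).comap_le
      (E.measurable_dualVar hδ (comap_measurable _)) (hI.measurable_context k hk)
      ((IndepFun_iff_Indep _ _ _).mp (hctx k hk).2) (measurable_uncurry_truncGap hB' l D)
      (.of_bound hmeas.aestronglyMeasurable _ (ae_of_all _ fun ω => abs_truncGap_le hB' hD l _ _))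
      fun y => ?_
    rw [(hctx k hk).1]
    exact integral_truncGap hB' l D y

end Deviations

section Pathwise

namespace EstimationProcedure

variable {Ω X A : Type*} {d t T : ℕ} [MeasurableSpace X] [MeasurableSpace A] {p : Problem X A d}
  {I : Interaction Ω X A d} {E : EstimationProcedure X A d} {B l : Fin d → ℝ} {b γ δ U : ℝ}
  {ω : Ω}

/-- The event of the estimation guarantee `IsAccurate`: the estimates at times `0, …, T` are within
the error functions at level `δ`. -/
def AccurateAt (E : EstimationProcedure X A d) (p : Problem X A d) (I : Interaction Ω X A d)
    (T : ℕ) (δ : ℝ) (ω : Ω) : Prop :=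
  ∀ t ≤ T, ∀ (x : X) (a : A),
    |E.rhat t (I.history t ω) x a - p.reward x a| ≤ E.err t (I.pairs t ω) x a δ ∧
    ∀ i, |E.chat t (I.history t ω) x a i - p.cost x a i| ≤ E.err t (I.pairs t ω) x a δ

/-- The error `ε_t(x_{t+1}, a_{t+1}, δ)` of round `t + 1`, a summand of `β_{T,δ}`. -/
def roundErr (E : EstimationProcedure X A d) (I : Interaction Ω X A d) (δ : ℝ) (t : ℕ) (ω : Ω) :
    ℝ :=
  E.err t (I.pairs t ω) (I.context (t + 1) ω) (I.action (t + 1) ω) δ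

/-- The excess of the optimistic cost estimate of round `t + 1` over `B - b·1`: the gradient step
taken by the dual variables in that round. -/
noncomputable def lcbExcess (E : EstimationProcedure X A d) (B : Fin d → ℝ) (b δ : ℝ)
    (I : Interaction Ω X A d) (t : ℕ) (ω : Ω) : Fin d → ℝ :=
  E.clcb δ I t ω (I.context (t + 1) ω) (I.action (t + 1) ω) - withMargin B b

theorem sum_roundErr_le_beta (hδ : δ ∈ Set.Ioc (0 : ℝ) 1) (ht : t ≤ T) :
    ∑ s ∈ Finset.range t, E.roundErr I δ s ω ≤ E.beta I T δ ω :=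
  Finset.sum_le_sum_of_subset_of_nonneg (Finset.range_mono ht)
    fun _ _ _ => (E.err_mem _ _ _ _ δ hδ).1

theorem beta_nonneg (hδ : δ ∈ Set.Ioc (0 : ℝ) 1) : 0 ≤ E.beta I T δ ω :=
  sum_roundErr_le_beta hδ T.zero_le

theorem clcb_mem (E : EstimationProcedure X A d) (δ : ℝ) (I : Interaction Ω X A d) (t : ℕ) (ω : Ω)
    (x : X) (a : A) : E.clcb δ I t ω x a ∈ Set.Icc (-1 : Fin d → ℝ) 1 :=
  ⟨fun _ => le_min (le_max_right _ _) (by norm_num), fun _ => min_le_right _ _⟩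

theorem euclNorm_lcbExcess_le (hB : withMargin B b ∈ Set.Icc (-1 : Fin d → ℝ) 1) (t : ℕ) :
    euclNorm (E.lcbExcess B b δ I t ω) ≤ 2 * √d :=
  euclNorm_sub_le_two_mul_sqrt (E.clcb_mem δ I t ω _ _) hB

section DualVar

theorem dualVar_succ (t : ℕ) : E.dualVar B b γ δ I ω (t + 1) =
    (E.dualVar B b γ δ I ω t + γ • E.lcbExcess B b δ I t ω)⁺ := rfl

theorem dualVar_nonneg (t : ℕ) : 0 ≤ E.dualVar B b γ δ I ω t := by
  cases t with
  | zero => exact le_rfl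
  | succ t => exact posPart_nonneg _

theorem smul_sum_lcbExcess_le_dualVar (t : ℕ) :
    γ • ∑ s ∈ Finset.range t, E.lcbExcess B b δ I s ω ≤ E.dualVar B b γ δ I ω t := by
  induction t with
  | zero => simp [dualVar]
  | succ t ih =>
    rw [Finset.sum_range_succ, smul_add, dualVar_succ]
    exact (add_le_add_left ih _).trans (le_posPart _)

theorem euclNorm_dualVar_zero_sub : euclNorm (E.dualVar B b γ δ I ω 0 - l) = euclNorm l := by
  rw [dualVar, zero_sub, euclNorm_neg]

theorem euclNorm_dualVar_sub_le (hB : withMargin B b ∈ Set.Icc (-1 : Fin d → ℝ) 1) (hγ : 0 ≤ γ)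
    (hl : 0 ≤ l) (t : ℕ) :
    euclNorm (E.dualVar B b γ δ I ω t - l) ≤ euclNorm l + 2 * γ * √d * t := by
  induction t with
  | zero => simp [euclNorm_dualVar_zero_sub]
  | succ t ih =>
    have hstep : γ * euclNorm (E.lcbExcess B b δ I t ω) ≤ γ * (2 * √d) :=
      mul_le_mul_of_nonneg_left (euclNorm_lcbExcess_le hB t) hγ
    calc euclNorm (E.dualVar B b γ δ I ω (t + 1) - l)
        ≤ euclNorm (E.dualVar B b γ δ I ω t + γ • E.lcbExcess B b δ I t ω - l) :=
          euclNorm_posPart_sub_le hl _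
      _ ≤ euclNorm (E.dualVar B b γ δ I ω t - l) + γ * euclNorm (E.lcbExcess B b δ I t ω) := by
          rw [add_sub_right_comm, ← abs_of_nonneg hγ, ← euclNorm_smul, abs_of_nonneg hγ]
          exact euclNorm_add_le _ _
      _ ≤ euclNorm l + 2 * γ * √d * (t + 1 : ℕ) := by
          push_cast
          linarith

theorem euclNorm_dualVar_sub_sq_le (hB : withMargin B b ∈ Set.Icc (-1 : Fin d → ℝ) 1)
    (hl : 0 ≤ l) (t : ℕ) :
    euclNorm (E.dualVar B b γ δ I ω t - l) ^ 2 ≤ euclNorm l ^ 2 +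
      2 * γ * ∑ s ∈ Finset.range t,
        E.lcbExcess B b δ I s ω ⬝ᵥ (E.dualVar B b γ δ I ω s - l) +
      4 * d * t * γ ^ 2 := by
  induction t with
  | zero => simp [euclNorm_dualVar_zero_sub]
  | succ t ih =>
    have hstep := euclNorm_posPart_add_smul_sub_sq_le hl (E.dualVar B b γ δ I ω t)
      (E.lcbExcess B b δ I t ω) γ
    have hnorm : euclNorm (E.lcbExcess B b δ I t ω) ^ 2 ≤ 4 * d := by
      refine (pow_le_pow_left₀ (euclNorm_nonneg _) (euclNorm_lcbExcess_le hB t) 2).trans_eq ?_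
      rw [mul_pow, Real.sq_sqrt d.cast_nonneg]
      norm_num
    have hnorm_mul := mul_le_mul_of_nonneg_left hnorm (sq_nonneg γ)
    rw [dualVar_succ, Finset.sum_range_succ]
    push_cast
    linarith

end DualVar

namespace AccurateAt

theorem reward_le_rucb (h : E.AccurateAt p I T δ ω) (ht : t ≤ T) (x : X) (a : A) :
    p.reward x a ≤ E.rucb δ I t ω x a := by
  refine le_min (le_max_of_le_left ?_) (p.reward_mem x a).2
  linarith [(abs_le.mp (h t ht x a).1).1]

theorem rucb_le (h : E.AccurateAt p I T δ ω) (hδ : δ ∈ Set.Ioc (0 : ℝ) 1) (ht : t ≤ T)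
    (x : X) (a : A) :
    E.rucb δ I t ω x a ≤ p.reward x a + 2 * E.err t (I.pairs t ω) x a δ := by
  have herr := (E.err_mem t (I.pairs t ω) x a δ hδ).1
  refine (min_le_left _ _).trans (max_le ?_ ?_)
  · linarith [(abs_le.mp (h t ht x a).1).2]
  · linarith [(p.reward_mem x a).1]

theorem clcb_le_cost (h : E.AccurateAt p I T δ ω) (ht : t ≤ T) (x : X) (a : A) :
    E.clcb δ I t ω x a ≤ p.cost x a := by
  intro i
  refine (min_le_left _ _).trans (max_le ?_ ((p.cost_mem x a).1 i))
  linarith [(abs_le.mp ((h t ht x a).2 i)).2]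

theorem cost_le_clcb (h : E.AccurateAt p I T δ ω) (hδ : δ ∈ Set.Ioc (0 : ℝ) 1) (ht : t ≤ T)
    (x : X) (a : A) (i : Fin d) :
    p.cost x a i ≤ E.clcb δ I t ω x a i + 2 * E.err t (I.pairs t ω) x a δ := by
  have herr := (E.err_mem t (I.pairs t ω) x a δ hδ).1
  have hcost : p.cost x a i ≤ 1 := (p.cost_mem x a).2 i
  rw [← sub_le_iff_le_add]
  refine le_min (le_max_of_le_left ?_) ?_
  · linarith [(abs_le.mp ((h t ht x a).2 i)).1]
  · linarith

theorem cost_dotProduct_le (h : E.AccurateAt p I T δ ω) (hδ : δ ∈ Set.Ioc (0 : ℝ) 1) (ht : t ≤ T)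
    (hl : 0 ≤ l) (x : X) (a : A) :
    p.cost x a ⬝ᵥ l ≤
      E.clcb δ I t ω x a ⬝ᵥ l + 2 * √d * euclNorm l * E.err t (I.pairs t ω) x a δ := by
  set ε := E.err t (I.pairs t ω) x a δ
  have hε : 0 ≤ ε := (E.err_mem t (I.pairs t ω) x a δ hδ).1
  calc p.cost x a ⬝ᵥ l ≤ ∑ i, (E.clcb δ I t ω x a i + 2 * ε) * l i :=
        Finset.sum_le_sum fun i _ =>
          mul_le_mul_of_nonneg_right (h.cost_le_clcb hδ ht x a i) (hl i)
    _ = E.clcb δ I t ω x a ⬝ᵥ l + 2 * ε * ∑ i, l i := by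
        simp only [add_mul, Finset.sum_add_distrib, Finset.mul_sum, dotProduct]
    _ ≤ E.clcb δ I t ω x a ⬝ᵥ l + 2 * ε * (√d * euclNorm l) := by
        gcongr
        exact sum_le_sqrt_mul_euclNorm l
    _ = E.clcb δ I t ω x a ⬝ᵥ l + 2 * √d * euclNorm l * ε := by ring

section Regret

variable [Fintype A] [Nonempty A]

theorem lagrangianMax_dualVar_le_score (h : E.AccurateAt p I T δ ω)
    (hplay : E.PlayedBy B b γ δ I T) (ht : t < T) :
    lagrangianMax p (withMargin B b) (E.dualVar B b γ δ I ω t) (I.context (t + 1) ω) ≤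
      E.score B b γ δ I t ω (I.action (t + 1) ω) :=
  lagrangianMax_le fun a =>
    (sub_le_sub (h.reward_le_rucb ht.le _ a) (dotProduct_le_dotProduct_of_nonneg_right
      (sub_le_sub_right (h.clcb_le_cost ht.le _ a) _) (dualVar_nonneg t))).trans
      (hplay t ht ω a)

theorem lcbExcess_dotProduct_sub_le (h : E.AccurateAt p I T δ ω) (hδ : δ ∈ Set.Ioc (0 : ℝ) 1)
    (hplay : E.PlayedBy B b γ δ I T) (hl : 0 ≤ l) (ht : t < T) :
    E.lcbExcess B b δ I t ω ⬝ᵥ (E.dualVar B b γ δ I ω t - l) ≤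
      lagrangianMax p (withMargin B b) l (I.context (t + 1) ω) -
        lagrangianMax p (withMargin B b) (E.dualVar B b γ δ I ω t) (I.context (t + 1) ω) +
      2 * (1 + √d * euclNorm l) * E.roundErr I δ t ω := by
  have hscore := h.lagrangianMax_dualVar_le_score hplay ht
  have hreward := h.rucb_le hδ ht.le (I.context (t + 1) ω) (I.action (t + 1) ω)
  have hcost := h.cost_dotProduct_le hδ ht.le hl (I.context (t + 1) ω) (I.action (t + 1) ω)
  have hmax := le_lagrangianMax p (withMargin B b) l (I.context (t + 1) ω) (I.action (t + 1) ω)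
  simp only [lcbExcess, roundErr, score, dotProduct_sub, sub_dotProduct] at *
  linarith

theorem sum_lcbExcess_dotProduct_sub_le (h : E.AccurateAt p I T δ ω)
    (hδ : δ ∈ Set.Ioc (0 : ℝ) 1) (hplay : E.PlayedBy B b γ δ I T)
    (hl : IsDualOptimal p (withMargin B b) l) (ht : t ≤ T) {D : ℝ}
    (hD : ∀ s < t, euclNorm (E.dualVar B b γ δ I ω s - l) ≤ D) :
    ∑ s ∈ Finset.range t, E.lcbExcess B b δ I s ω ⬝ᵥ (E.dualVar B b γ δ I ω s - l) ≤
      ∑ s ∈ Finset.range t, truncGap p (withMargin B b) l D (E.dualVar B b γ δ I ω s)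
        (I.context (s + 1) ω) + 2 * (1 + √d * euclNorm l) * E.beta I T δ ω := by
  have hround : ∀ s ∈ Finset.range t,
      E.lcbExcess B b δ I s ω ⬝ᵥ (E.dualVar B b γ δ I ω s - l) ≤
        truncGap p (withMargin B b) l D (E.dualVar B b γ δ I ω s) (I.context (s + 1) ω) +
          2 * (1 + √d * euclNorm l) * E.roundErr I δ s ω := fun s hs => by
    have hst := Finset.mem_range.mp hs
    have hopt := hl.2 (E.dualVar B b γ δ I ω s) (dualVar_nonneg s)
    rw [truncGap_of_le (hD s hst), dualGap]
    linarith [h.lcbExcess_dotProduct_sub_le hδ hplay hl.1 (hst.trans_le ht)]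
  refine (Finset.sum_le_sum hround).trans ?_
  rw [Finset.sum_add_distrib, ← Finset.mul_sum]
  have hnorm := euclNorm_nonneg l
  gcongr
  exact sum_roundErr_le_beta hδ ht

end Regret

end AccurateAt

end EstimationProcedure

end Pathwise

section Elementary

theorem exists_lt_le_add_mul_le {a x h : ℝ} {T : ℕ} (ha : a ≤ x) (hx : x ≤ a + h * T)
    (hT : 1 ≤ T) : ∃ k < T, x ≤ a + h * (k + 1) ∧ a + h * (k + 1) ≤ x + h := by
  induction T, hT using Nat.le_induction with
  | base => exact ⟨0, one_pos, by simpa using hx, by simpa using ha⟩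
  | succ T _ ih =>
    rcases le_or_gt x (a + h * T) with hxT | hxT
    · obtain ⟨k, hk, hlevel⟩ := ih hxT
      exact ⟨k, hk.trans T.lt_succ_self, hlevel⟩
    · exact ⟨T, T.lt_succ_self, mod_cast hx, by linarith⟩

theorem le_add_of_sq_le {N D K q U γ : ℝ} (hN : 0 ≤ N) (hK : 0 ≤ K) (hγ : 0 ≤ γ) (hq : 1 ≤ q)
    (hqU : 2 * q ≤ U) (hD : D ≤ N + 2 * γ * q)
    (hNsq : N ^ 2 ≤ K ^ 2 + 2 * γ * (3 * U * D + 2 * (1 + q * K) * U) + γ ^ 2 * U ^ 2) :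
    N ≤ K + 1 + 7 * (γ * q * U) := by
  have hU : 0 ≤ U := by linarith
  set g := γ * q * U with hg
  have hg0 : 0 ≤ g := by positivity
  have hγU0 : 0 ≤ γ * U := by positivity
  have hγU : γ * U ≤ g := by
    rw [hg, mul_right_comm]
    exact le_mul_of_one_le_right hγU0 hq
  have hγUN : γ * U * N ≤ g * N := mul_le_mul_of_nonneg_right hγU hN
  have hγU_sq : (γ * U) ^ 2 ≤ g ^ 2 := pow_le_pow_left₀ hγU0 hγU 2
  have hγUD : γ * U * D ≤ γ * U * N + (γ * U) ^ 2 := by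
    have hqγ : γ * (2 * q) ≤ γ * U := mul_le_mul_of_nonneg_left hqU hγ
    rw [sq, ← mul_add]
    exact mul_le_mul_of_nonneg_left (by linarith) hγU0
  have hgK : γ * U * (q * K) = g * K := by ring
  have hsq : (N - 3 * g) ^ 2 ≤ (K + 1 + 4 * g) ^ 2 := by
    have hgK0 : 0 ≤ g * K := by positivity
    linear_combination hNsq + 6 * hγUD + 6 * hγUN + 7 * hγU_sq + 4 * hγU + 4 * hgK +
      4 * hgK0 + 2 * hK + 4 * hg0
  linarith [(abs_le_of_sq_le_sq' hsq (by positivity)).2]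

variable {d T L U : ℝ}

theorem two_mul_sqrt_le_of_two_mul_sqrt_mul_le (hd : 0 ≤ d) (hT : 1 ≤ T) (hL : 1 ≤ L)
    (hU : 2 * √(d * T * L) ≤ U) : 2 * √d ≤ U := by
  have hTL : 1 ≤ T * L := one_le_mul_of_one_le_of_one_le hT hL
  refine le_trans ?_ hU
  gcongr
  rw [mul_assoc]
  exact le_mul_of_one_le_right hd hTL

theorem four_mul_mul_le_sq_of_two_mul_sqrt_mul_le (hd : 0 ≤ d) (hT : 0 ≤ T) (hL : 1 ≤ L)
    (hU : 2 * √(d * T * L) ≤ U) : 4 * d * T ≤ U ^ 2 := by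
  have hsq := pow_le_pow_left₀ (by positivity) hU 2
  rw [mul_pow, Real.sq_sqrt (by positivity)] at hsq
  linarith [le_mul_of_one_le_right (mul_nonneg hd hT) hL]

theorem four_mul_sqrt_mul_sqrt_le (hd : 0 ≤ d) (hU : 2 * √(d * T * L) ≤ U) :
    4 * √d * √(2 * T * L) ≤ 3 * U := by
  have hsqrt2 : 2 * √2 ≤ 3 := by
    rw [← le_div_iff₀' two_pos, Real.sqrt_le_left (by norm_num)]
    norm_num
  calc 4 * √d * √(2 * T * L) = 2 * √2 * (2 * √(d * T * L)) := by
        rw [mul_assoc 2 T, mul_assoc d, Real.sqrt_mul zero_le_two, Real.sqrt_mul hd]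
        ring
    _ ≤ 3 * U := mul_le_mul hsqrt2 hU (by positivity) zero_le_three

end Elementary

namespace EstimationProcedure.AccurateAt

variable {Ω X A : Type*} {d t T : ℕ} [MeasurableSpace X] [MeasurableSpace A] {p : Problem X A d}
  {I : Interaction Ω X A d} {E : EstimationProcedure X A d} {B l : Fin d → ℝ} {b γ δ L U : ℝ}
  {ω : Ω}

theorem euclNorm_dualVar_sub_le [Fintype A] [Nonempty A] (h : E.AccurateAt p I T δ ω)
    (hδ : δ ∈ Set.Ioc (0 : ℝ) 1) (hplay : E.PlayedBy B b γ δ I T)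
    (hB : withMargin B b ∈ Set.Icc (-1 : Fin d → ℝ) 1) (hγ : 0 ≤ γ) (hT : 1 ≤ T)
    (hl : IsDualOptimal p (withMargin B b) l) (hL : 1 ≤ L)
    (hβ : E.beta I T δ ω ≤ U) (hU : 2 * √(d * T * L) ≤ U)
    (hgap : ∀ k < T, ∀ n ≤ T, ∑ s ∈ Finset.range n,
      truncGap p (withMargin B b) l (euclNorm l + 2 * γ * √d * (k + 1))
        (E.dualVar B b γ δ I ω s) (I.context (s + 1) ω) ≤
      4 * √d * (euclNorm l + 2 * γ * √d * (k + 1)) * √(2 * T * L))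
    (ht : t ≤ T) :
    euclNorm (E.dualVar B b γ δ I ω t - l) ≤ euclNorm l + 1 + 7 * (γ * √d * U) := by
  rcases Nat.eq_zero_or_pos d with rfl | hd
  · simp [euclNorm_eq]
  set N : ℕ → ℝ := fun s => euclNorm (E.dualVar B b γ δ I ω s - l)
  obtain ⟨n, hn, hmax⟩ := Finset.exists_max_image (Finset.range (T + 1)) N
    Finset.nonempty_range_add_one
  simp only [Finset.mem_range, Nat.lt_succ_iff] at hn hmax
  refine (hmax t ht).trans ?_
  have hT' : (1 : ℝ) ≤ T := mod_cast hT
  have hnT : (n : ℝ) ≤ T := mod_cast hn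
  have hl0 := euclNorm_nonneg l
  obtain ⟨k, hk, hNk, hkN⟩ := exists_lt_le_add_mul_le (h := 2 * γ * √d)
    (euclNorm_dualVar_zero_sub.ge.trans (hmax 0 T.zero_le))
    ((EstimationProcedure.euclNorm_dualVar_sub_le hB hγ hl.1 n).trans (by gcongr)) hT
  set D := euclNorm l + 2 * γ * √d * (k + 1)
  have hregret : ∑ s ∈ Finset.range n, E.lcbExcess B b δ I s ω ⬝ᵥ (E.dualVar B b γ δ I ω s - l) ≤
      3 * U * D + 2 * (1 + √d * euclNorm l) * U := by
    refine (h.sum_lcbExcess_dotProduct_sub_le hδ hplay hl hn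
      fun s hs => (hmax s (hs.le.trans hn)).trans hNk).trans (add_le_add ?_ (by gcongr))
    refine (hgap k hk n hn).trans ?_
    rw [mul_right_comm]
    exact mul_le_mul_of_nonneg_right (four_mul_sqrt_mul_sqrt_le d.cast_nonneg hU) (by positivity)
  have hdT : 4 * d * n ≤ U ^ 2 :=
    (by gcongr : (4 * d * n : ℝ) ≤ 4 * d * T).trans
      (four_mul_mul_le_sq_of_two_mul_sqrt_mul_le d.cast_nonneg T.cast_nonneg hL hU)
  refine le_add_of_sq_le (euclNorm_nonneg _) hl0 hγ (Real.one_le_sqrt.mpr (mod_cast hd))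
    (two_mul_sqrt_le_of_two_mul_sqrt_mul_le d.cast_nonneg hT' hL hU) hkN ?_
  refine (euclNorm_dualVar_sub_sq_le hB hl.1 n).trans ?_
  rw [mul_comm (γ ^ 2)]
  gcongr

theorem sum_cost_sub_le (h : E.AccurateAt p I T δ ω) (hδ : δ ∈ Set.Ioc (0 : ℝ) 1) (ht : t ≤ T)
    (i : Fin d) :
    (∑ τ ∈ Finset.Icc 1 t, I.cost τ ω - (t : ℝ) • withMargin B b) i ≤
      (∑ s ∈ Finset.range t, E.lcbExcess B b δ I s ω) i +
        ∑ s ∈ Finset.range t, costNoise p I i s ω + 2 * E.beta I T δ ω := by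
  have hshift : (∑ τ ∈ Finset.Icc 1 t, I.cost τ ω - (t : ℝ) • withMargin B b) i =
      ∑ s ∈ Finset.range t, (I.cost (s + 1) ω i - withMargin B b i) := by
    rw [Finset.sum_sub_distrib, Finset.range_eq_Ico,
      Finset.sum_Ico_add' (fun s => I.cost s ω i) 0 t 1]
    simp [Finset.sum_apply, Finset.Ico_add_one_right_eq_Icc]
  have hround : ∀ s ∈ Finset.range t, I.cost (s + 1) ω i - withMargin B b i ≤
      E.lcbExcess B b δ I s ω i + costNoise p I i s ω + 2 * E.roundErr I δ s ω := fun s hs => by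
    have hcost := h.cost_le_clcb hδ ((Finset.mem_range.mp hs).le.trans ht)
      (I.context (s + 1) ω) (I.action (s + 1) ω) i
    rw [lcbExcess, costNoise, roundErr, Pi.sub_apply]
    linarith
  rw [hshift, Finset.sum_apply]
  refine (Finset.sum_le_sum hround).trans ?_
  rw [Finset.sum_add_distrib, Finset.sum_add_distrib, ← Finset.mul_sum]
  gcongr
  exact sum_roundErr_le_beta hδ ht

theorem euclNorm_posPart_sum_cost_sub_le (h : E.AccurateAt p I T δ ω)
    (hδ : δ ∈ Set.Ioc (0 : ℝ) 1) (hγ : 0 < γ) (hβ : E.beta I T δ ω ≤ U) (ht : t ≤ T)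
    (hnoise : ∀ i, ∑ s ∈ Finset.range t, costNoise p I i s ω ≤ 2 * U) :
    euclNorm (∑ τ ∈ Finset.Icc 1 t, I.cost τ ω - (t : ℝ) • withMargin B b)⁺ ≤
      euclNorm (E.dualVar B b γ δ I ω t) / γ + 4 * √d * U := by
  have hU : 0 ≤ U := (beta_nonneg hδ).trans hβ
  have hdual : ∑ s ∈ Finset.range t, E.lcbExcess B b δ I s ω ≤
      γ⁻¹ • E.dualVar B b γ δ I ω t :=
    (le_inv_smul_iff_of_pos hγ).mpr (smul_sum_lcbExcess_le_dualVar t)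
  have hle : ∑ τ ∈ Finset.Icc 1 t, I.cost τ ω - (t : ℝ) • withMargin B b ≤
      γ⁻¹ • E.dualVar B b γ δ I ω t + fun _ => 4 * U := fun i => by
    rw [Pi.add_apply]
    linarith [h.sum_cost_sub_le (B := B) (b := b) hδ ht i, hdual i, hnoise i]
  have hnonneg : 0 ≤ γ⁻¹ • E.dualVar B b γ δ I ω t + fun _ => 4 * U :=
    add_nonneg (smul_nonneg (inv_nonneg.mpr hγ.le) (dualVar_nonneg t)) fun _ => by positivity
  refine (euclNorm_posPart_le_of_le hle hnonneg).trans ((euclNorm_add_le _ _).trans_eq ?_)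
  rw [euclNorm_smul, euclNorm_const, abs_of_pos (inv_pos.mpr hγ),
    abs_of_nonneg (mul_nonneg zero_le_four hU)]
  ring

theorem euclNorm_posPart_sum_cost_sub_le_of_isDualOptimal [Fintype A] [Nonempty A]
    (h : E.AccurateAt p I T δ ω) (hδ : δ ∈ Set.Ioc (0 : ℝ) 1) (hplay : E.PlayedBy B b γ δ I T)
    (hB : withMargin B b ∈ Set.Icc (-1 : Fin d → ℝ) 1) (hγ : 0 < γ) (hT : 1 ≤ T)
    (hl : IsDualOptimal p (withMargin B b) l) (hL : 1 ≤ L)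
    (hβ : E.beta I T δ ω ≤ U) (hU : 2 * √(d * T * L) ≤ U)
    (hgap : ∀ k < T, ∀ n ≤ T, ∑ s ∈ Finset.range n,
      truncGap p (withMargin B b) l (euclNorm l + 2 * γ * √d * (k + 1))
        (E.dualVar B b γ δ I ω s) (I.context (s + 1) ω) ≤
      4 * √d * (euclNorm l + 2 * γ * √d * (k + 1)) * √(2 * T * L))
    (ht : t ≤ T) (hnoise : ∀ i, ∑ s ∈ Finset.range t, costNoise p I i s ω ≤ 2 * U) :
    euclNorm (∑ τ ∈ Finset.Icc 1 t, I.cost τ ω - (t : ℝ) • withMargin B b)⁺ ≤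
      (1 + 2 * euclNorm l) / γ + 11 * √d * U := by
  have hdual : euclNorm (E.dualVar B b γ δ I ω t) ≤ 1 + 2 * euclNorm l + 7 * √d * U * γ := by
    have htriangle := euclNorm_add_le (E.dualVar B b γ δ I ω t - l) l
    rw [sub_add_cancel] at htriangle
    linarith [h.euclNorm_dualVar_sub_le hδ hplay hB hγ.le hT hl hL hβ hU hgap ht]
  calc euclNorm (∑ τ ∈ Finset.Icc 1 t, I.cost τ ω - (t : ℝ) • withMargin B b)⁺
      ≤ euclNorm (E.dualVar B b γ δ I ω t) / γ + 4 * √d * U :=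
        h.euclNorm_posPart_sum_cost_sub_le hδ hγ hβ ht hnoise
    _ ≤ (1 + 2 * euclNorm l + 7 * √d * U * γ) / γ + 4 * √d * U := by gcongr
    _ = (1 + 2 * euclNorm l) / γ + 11 * √d * U := by
        rw [add_div, mul_div_cancel_right₀ _ hγ.ne']
        ring

end EstimationProcedure.AccurateAt

section ConfidenceLevels

theorem mul_exp_neg_log_div_le {x y : ℝ} (hx : 0 ≤ x) (hy : 0 < y) :
    x * Real.exp (-Real.log (x / y)) ≤ y := by
  rcases hx.eq_or_lt with rfl | hx
  · simpa using hy.le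
  · rw [Real.exp_neg, Real.exp_log (div_pos hx hy), inv_div, mul_div_cancel₀ _ hx.ne']

theorem one_le_log_div {x δ : ℝ} (hx : 1 ≤ x) (hδ : δ ∈ Set.Ioc (0 : ℝ) 1) :
    1 ≤ Real.log (x / (δ / 4)) := by
  have hδ4 : 0 < δ / 4 := div_pos hδ.1 zero_lt_four
  rw [Real.le_log_iff_exp_le (div_pos (zero_lt_one.trans_le hx) hδ4), le_div_iff₀ hδ4]
  have hexp : Real.exp 1 ≤ 4 := Real.exp_one_lt_d9.le.trans (by norm_num)
  calc Real.exp 1 * (δ / 4) ≤ 4 * (1 / 4) := by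
        gcongr
        exact hδ.2
    _ ≤ x := by linarith

end ConfidenceLevels

end CBwK

open CBwK in
theorem lemma1_general {Ω X A : Type*} {d : ℕ} [MeasurableSpace Ω] [MeasurableSpace X]
    [Fintype A] [Nonempty A] [MeasurableSpace A] [MeasurableSingletonClass A]
    {P : Measure Ω} [IsProbabilityMeasure P] {p : Problem X A d} {B : Fin d → ℝ} {b : ℝ}
    (hB : withMargin B b ∈ Set.Icc (-1 : Fin d → ℝ) 1) {T : ℕ} {δ : ℝ}
    (hδ : δ ∈ Set.Ioc (0 : ℝ) 1) {γ : ℝ} (hγ : 0 < γ) {E : EstimationProcedure X A d}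
    {I : Interaction Ω X A d} (hI : I.Follows p P T) (hctx : I.ContextsDrawnFrom p.ν P T)
    (hacc : HoldsWithProb P (1 - δ / 4) {ω | E.AccurateAt p I T (δ / 4) ω})
    (hplay : E.PlayedBy B b γ (δ / 4) I T) {l : Fin d → ℝ}
    (hl : IsDualOptimal p (withMargin B b) l) :
    HoldsWithProb P (1 - δ) {ω | ∀ t, 1 ≤ t → t ≤ T →
      euclNorm (∑ τ ∈ Finset.Icc 1 t, I.cost τ ω - (t : ℝ) • withMargin B b)⁺ ≤
        (1 + 2 * euclNorm l) / γ + 11 * √(d : ℝ) * E.upsilon I T δ ω} := by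
  have hδ4 : δ / 4 ∈ Set.Ioc (0 : ℝ) 1 := ⟨by linarith [hδ.1], by linarith [hδ.2]⟩
  have hl0 := euclNorm_nonneg l
  set L := Real.log ((T : ℝ) ^ 2 / (δ / 4))
  set L' := Real.log (2 * ((d : ℝ) + 1) * T / (δ / 4))
  have hgap := holdsWithProb_biInter (Finset.range T) fun k _ =>
    (isBoundedMartingaleDiff_truncGap (E := E) (B := B) (b := b) (γ := γ) (l := l) hB hδ4 hI hctx
      (by positivity : 0 ≤ euclNorm l + 2 * γ * √d * (k + 1))).holdsWithProb_sum_le L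
  have hnoise := holdsWithProb_biInter Finset.univ fun i _ =>
    (isBoundedMartingaleDiff_costNoise hI i).holdsWithProb_sum_le L'
  refine ((hacc.inter hgap).inter hnoise).mono ?_ ?_
  · rintro ω ⟨⟨hω, hω_gap⟩, hω_noise⟩ t ht htT
    simp only [Set.mem_iInter, Finset.mem_range, Finset.mem_univ, Set.mem_ofPred_eq,
      forall_const] at hω_gap hω_noise
    have hT : 1 ≤ T := ht.trans htT
    exact hω.euclNorm_posPart_sum_cost_sub_le_of_isDualOptimal hδ4 hplay hB hγ hT hl
      (one_le_log_div (one_le_pow₀ (mod_cast hT)) hδ) (le_max_left _ _)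
      ((le_max_left _ _).trans (le_max_right _ _)) hω_gap htT fun i => (hω_noise i t htT).trans
        (mul_le_mul_of_nonneg_left ((le_max_right _ _).trans (le_max_right _ _)) zero_le_two)
  · have hgap_prob : T * (T * Real.exp (-L)) ≤ δ / 4 := by
      rw [← mul_assoc, ← sq]
      exact mul_exp_neg_log_div_le (by positivity) hδ4.1
    have hnoise_prob : d * (T * Real.exp (-L')) ≤ δ / 4 := by
      have hd : (d : ℝ) ≤ 2 * (d + 1) := by linarith [d.cast_nonneg (α := ℝ)]
      calc d * (T * Real.exp (-L')) ≤ 2 * ((d : ℝ) + 1) * (T * Real.exp (-L')) := by gcongr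
        _ = 2 * ((d : ℝ) + 1) * T * Real.exp (-L') := (mul_assoc _ _ _).symm
        _ ≤ δ / 4 := mul_exp_neg_log_div_le (by positivity) hδ4.1
    rw [Finset.card_range, Finset.card_univ, Fintype.card_fin]
    linarith [hδ.1]

theorem lemma1 {Ω : Type u} {X : Type v} {A : Type w} {d : ℕ}
    [MeasurableSpace Ω] [MeasurableSpace X]
    [Fintype A] [Nonempty A] [MeasurableSpace A] [MeasurableSingletonClass A]
    (P : Measure Ω) [IsProbabilityMeasure P]
    (p : CBwK.Problem X A d) (B : Fin d → ℝ) (hB : B ∈ Set.Icc (0 : Fin d → ℝ) 1)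
    (T : ℕ) (δ : ℝ) (hδ : δ ∈ Set.Ioo (0 : ℝ) 1)
    (b : ℝ) (hb : 0 < b) (hbB : ∀ i, b < B i) (γ : ℝ) (hγ : 0 < γ)
    (hfeas : ∃ B' : Fin d → ℝ, (∀ i, B' i < B i - b) ∧ CBwK.Feasible p B')
    (E : CBwK.EstimationProcedure X A d)
    (hE : CBwK.EstimationProcedure.IsAccurate.{u} E p T)
    (I : CBwK.Interaction Ω X A d) (hI : I.Follows p P T)
    (hctx : I.ContextsDrawnFrom p.ν P T)
    (hplay : E.PlayedBy B b γ (δ / 4) I T) :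
    (∃ l, CBwK.IsDualOptimal p (CBwK.withMargin B b) l) ∧
    ∀ l, CBwK.IsDualOptimal p (CBwK.withMargin B b) l →
      CBwK.HoldsWithProb P (1 - δ) {ω | ∀ t, 1 ≤ t → t ≤ T →
        CBwK.euclNorm
            (∑ τ ∈ Finset.Icc 1 t, I.cost τ ω - (t : ℝ) • CBwK.withMargin B b)⁺ ≤
          (1 + 3 * CBwK.euclNorm l) / γ + 20 * √(d : ℝ) * E.upsilon I T δ ω} := by
  have hmargin : CBwK.withMargin B b ∈ Set.Icc (-1 : Fin d → ℝ) 1 :=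
    ⟨fun i => neg_one_lt_zero.le.trans (sub_pos.mpr (hbB i)).le,
      fun i => (sub_le_self _ hb.le).trans (hB.2 i)⟩
  have hδ4 : δ / 4 ∈ Set.Ioc (0 : ℝ) 1 := ⟨by linarith [hδ.1], by linarith [hδ.2]⟩
  obtain ⟨B', hB', hfeasible⟩ := hfeas
  refine ⟨hfeasible.exists_isDualOptimal hmargin hB', fun l hl =>
    (lemma1_general hmargin ⟨hδ.1, hδ.2.le⟩ hγ hI hctx (hE Ω P I hI _ hδ4) hplay hl).mono
      (fun ω hω t ht htT => (hω t ht htT).trans ?_) le_rfl⟩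
  have hupsilon : 0 ≤ E.upsilon I T δ ω := (E.beta_nonneg hδ4).trans (le_max_left _ _)
  have hl0 := CBwK.euclNorm_nonneg l
  gcongr <;> norm_num
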